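/- Let $n\ge 1$ and let $\Omega\subset\mathbb{R}^n$ be a bounded, uniformly convex domain, that is, a nonempty bounded open convex set for which there is $\kappa>0$ such that every $x_0\in\partial\Omega$ admits a unit vector $\nu$ with $\frac{\kappa}{2}|x-x_0|^2\le\langle x-x_0,\nu\rangle$ for all $x\in\Omega$ close to $x_0$ (if $\partial\Omega$ is of class $C^2$, this means that the principal curvatures of $\partial\Omega$ are bounded below by a positive constant). Let $\phi\in C^0(\partial\Omega)$ and let $\psi\in\left(-\frac{n\pi}{2},\frac{n\pi}{2}\right)$ be a constant. For a symmetric matrix $A$ with eigenvalues $\lambda_1,\dots,\lambda_n$ (counted with multiplicity) put $F(A)=\sum_{i=1}^n\arctan\lambda_i$. Then there is exactly one function $u\in C^0(\overline\Omega)$ that is a viscosity solution of the Dirichlet problem \[ F(D^2u)=\psi \ \text{ in } \Omega,\qquad u=\phi \ \text{ on } \partial\Omega . \] Here $u$ is a viscosity solution if $u=\phi$ on $\partial\Omega$ and, for every $f\in C^2(\Omega)$ and $x_0\in\Omega$: if $u-f$ has a local maximum at $x_0$, then $F(D^2f(x_0))\ge\psi$; and if $u-f$ has a local minimum at $x_0$,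 then $F(D^2f(x_0))\le\psi$. -/

import Mathlib

open Set Topology

noncomputable section

/-- The operator `F(A) = ∑ arctan λᵢ`, the `λᵢ` being the eigenvalues of `A` counted with
multiplicity (for a symmetric `A` all the roots of the characteristic polynomial are real). -/
def lagrangianPhase {n : ℕ} (A : Matrix (Fin n) (Fin n) ℝ) : ℝ :=
  (A.charpoly.roots.map Real.arctan).sum

/-- On symmetric matrices, `lagrangianPhase` is the sum over Mathlib's list of eigenvalues. -/
theorem lagrangianPhase_eq {n : ℕ} {A : Matrix (Fin n) (Fin n) ℝ} (hA : A.IsHermitian) :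
    lagrangianPhase A = ∑ i, Real.arctan (hA.eigenvalues i) := by
  simp [lagrangianPhase, hA.roots_charpoly_eq_eigenvalues, List.sum_ofFn]

/-- The Hessian matrix `D²f(x)`. -/
def hessianMatrix {n : ℕ} (f : EuclideanSpace ℝ (Fin n) → ℝ) (x : EuclideanSpace ℝ (Fin n)) :
    Matrix (Fin n) (Fin n) ℝ :=
  Matrix.of fun i j =>
    fderiv ℝ (fderiv ℝ f) x (EuclideanSpace.single i 1) (EuclideanSpace.single j 1)

/-- `u` is a viscosity subsolution of `F(D²u) = ψ` in the open set `Ω`, i.e. `F(D²u) ≥ ψ`: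
whenever a `C²` function touches `u` from above (up to a constant) at `x₀`, it satisfies
`F(D²f(x₀)) ≥ ψ`. -/
structure IsViscositySubsolution {n : ℕ} (Ω : Set (EuclideanSpace ℝ (Fin n))) (ψ : ℝ)
    (u : EuclideanSpace ℝ (Fin n) → ℝ) : Prop where
  usc : UpperSemicontinuousOn u Ω
  test : ∀ f : EuclideanSpace ℝ (Fin n) → ℝ, ContDiffOn ℝ 2 f Ω → ∀ x₀ ∈ Ω,
    IsLocalMaxOn (fun x => u x - f x) Ω x₀ → ψ ≤ lagrangianPhase (hessianMatrix f x₀)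

/-- `u` is a viscosity supersolution of `F(D²u) = ψ` in the open set `Ω`, i.e. `F(D²u) ≤ ψ`. -/
structure IsViscositySupersolution {n : ℕ} (Ω : Set (EuclideanSpace ℝ (Fin n))) (ψ : ℝ)
    (u : EuclideanSpace ℝ (Fin n) → ℝ) : Prop where
  lsc : LowerSemicontinuousOn u Ω
  test : ∀ f : EuclideanSpace ℝ (Fin n) → ℝ, ContDiffOn ℝ 2 f Ω → ∀ x₀ ∈ Ω,
    IsLocalMinOn (fun x => u x - f x) Ω x₀ → lagrangianPhase (hessianMatrix f x₀) ≤ ψ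

/-- `u` is continuous on the closure of `Ω`, solves `F(D²u) = ψ` in `Ω` in the viscosity sense
and equals `φ` on the boundary. Only the values of `u` on the closure of `Ω` and those of `φ` on
the boundary of `Ω` matter. -/
structure IsDirichletSolution {n : ℕ} (Ω : Set (EuclideanSpace ℝ (Fin n))) (ψ : ℝ)
    (φ u : EuclideanSpace ℝ (Fin n) → ℝ) : Prop where
  continuousOn : ContinuousOn u (closure Ω)
  subsolution : IsViscositySubsolution Ω ψ u
  supersolution : IsViscositySupersolution Ω ψ u
  boundary : ∀ x ∈ frontier Ω, u x = φ x

/-- Uniformly convex domains: nonempty open convex sets whose boundary has curvature bounded below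
by a positive constant `κ`. The bound says that, with inner unit normal `ν` at `x₀ ∈ ∂Ω`, near
`x₀` the set `Ω` lies in the region `κ/2 |x - x₀|² ≤ ⟨x - x₀, ν⟩`, that is, in the
ball of radius `1/κ` through `x₀` centred at `x₀ + ν/κ`. If `∂Ω` is `C²`, then locally
`Ω = {xₙ > (k₁ x₁² + ⋯ + kₙ₋₁ xₙ₋₁²)/2 + o(|x'|²)}` and the existence of such a `κ > 0` says
exactly that the principal curvatures `kᵢ` of `∂Ω` are bounded below by a positive constant. No
regularity of `∂Ω` is required. -/
structure IsUniformlyConvexDomain {n : ℕ} (Ω : Set (EuclideanSpace ℝ (Fin n))) : Prop where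
  isOpen : IsOpen Ω
  nonempty : Ω.Nonempty
  convex : Convex ℝ Ω
  curvature : ∃ κ : ℝ, 0 < κ ∧ ∀ x₀ ∈ frontier Ω, ∃ ν : EuclideanSpace ℝ (Fin n), ‖ν‖ = 1 ∧
    ∀ᶠ x in 𝓝[Ω] x₀, κ / 2 * ‖x - x₀‖ ^ 2 ≤ inner ℝ (x - x₀) ν

end

open scoped RealInnerProductSpace

noncomputable section

/-! ### Eigenvalues and the phase of a symmetric operator -/

section Phase

variable {E : Type*} [NormedAddCommGroup E] [InnerProductSpace ℝ E] [FiniteDimensional ℝ E]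

/-! Uniqueness is a comparison principle and existence is Perron's method. Of the operator they use
only that F(A) is monotone in A and that c ↦ F(A + cI) is continuous and strictly increasing;
neither concavity nor uniform ellipticity enters.

Comparison (`IsJetSubsolution.le_of_le_frontier`): if u - v is positive somewhere, add δ|x|²/2 to u,
with δ so small that the maximum stays interior. The theorem on sums
(`exists_isSuperjet_add_nonpos`) gives second order jets A of the perturbed u and B of -v with A + B
≤ 0, whence ψ ≤ F(A - δI) < F(A) ≤ F(-B) ≤ ψ. To get the jets, replace both functions by
sup-convolutions, which are convex up to a quadratic. Tilting their sum by small slopes gives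
contact points, and the slope is a Lipschitz function on the contact set whose image contains a
ball. The contact set is therefore not null. By Rademacher's theorem and Lebesgue density, both
subgradient maps are differentiable at one of its points, and the second order expansions there are
carried back to the original functions.

Existence: the greatest subsolution u below the boundary data is found as an upper semicontinuous
hull, and its lower semicontinuous hull v is a supersolution by the bump construction. Quadratic
barriers at each boundary point force both to equal φ there, and comparison gives u ≤ v ≤ u. Uniform
convexity and the range of ψ serve only to build these barriers: the former lets a linear term
dominate a quadratic one on ∂Ω, the latter makes n arctan c ≥ |ψ| attainable. -/

theorem LinearMap.IsSymmetric.inner_apply_self_eq_sum {n : ℕ} {S : E →ₗ[ℝ] E} (hS : S.IsSymmetric)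
    (hn : Module.finrank ℝ E = n) (x : E) :
    ⟪S x, x⟫ = ∑ j, hS.eigenvalues hn j * ⟪hS.eigenvectorBasis hn j, x⟫ ^ 2 := by
  rw [← (hS.eigenvectorBasis hn).sum_inner_mul_inner (S x) x]
  refine Finset.sum_congr rfl fun j _ => ?_
  rw [hS, hS.apply_eigenvectorBasis hn j, inner_smul_right, real_inner_comm x]
  simp
  ring

/-- Weyl monotonicity: the ordered eigenvalues are monotone in the operator. -/
theorem LinearMap.IsSymmetric.eigenvalues_le_of_le {n : ℕ} {S T : E →ₗ[ℝ] E} (hS : S.IsSymmetric)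
    (hT : T.IsSymmetric) (hn : Module.finrank ℝ E = n) (h : ∀ x, ⟪S x, x⟫ ≤ ⟪T x, x⟫)
    (i : Fin n) : hS.eigenvalues hn i ≤ hT.eigenvalues hn i := by
  set e := hS.eigenvectorBasis hn
  set b := hT.eigenvectorBasis hn
  -- These n - 1 conditions confine a nonzero x to the span of the `e j` with j ≤ i and of the `b j`
  -- with j ≥ i. As eigenvalues are listed in decreasing order, the i-th one bounds ⟪S x, x⟫ from
  -- below and ⟪T x, x⟫ from above.
  let L : E →ₗ[ℝ] ({j : Fin n // j ≠ i} → ℝ) :=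
    LinearMap.pi fun j => if i < j.1 then (innerₗ E (e j.1)) else innerₗ E (b j.1)
  have hker : LinearMap.ker L ≠ ⊥ := by
    apply LinearMap.ker_ne_bot_of_finrank_lt
    have hi := i.2
    simp only [Module.finrank_fintype_fun_eq_card, Fintype.card_subtype_compl, Fintype.card_fin,
      Fintype.card_unique, hn]
    omega
  obtain ⟨x, hx, hx0⟩ := (Submodule.ne_bot_iff _).1 hker
  have hLx : ∀ j, (hj : j ≠ i) → (if i < j then ⟪e j, x⟫ else ⟪b j, x⟫) = 0 := by
    intro j hj
    have := congrFun (LinearMap.mem_ker.1 hx) ⟨j, hj⟩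
    simp only [L, LinearMap.pi_apply] at this
    split_ifs at this ⊢ with hij <;> simpa using this
  have hS' : hS.eigenvalues hn i * ‖x‖ ^ 2 ≤ ⟪S x, x⟫ := by
    rw [hS.inner_apply_self_eq_sum hn, ← e.sum_sq_inner_right x, Finset.mul_sum]
    refine Finset.sum_le_sum fun j _ => ?_
    by_cases hij : i < j
    · have := hLx j hij.ne'
      rw [if_pos hij] at this
      simp [e] at this
      simp [e, this]
    · exact mul_le_mul_of_nonneg_right (hS.eigenvalues_antitone hn (not_lt.1 hij)) (sq_nonneg _)
  have hT' : ⟪T x, x⟫ ≤ hT.eigenvalues hn i * ‖x‖ ^ 2 := by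
    rw [hT.inner_apply_self_eq_sum hn, ← b.sum_sq_inner_right x, Finset.mul_sum]
    refine Finset.sum_le_sum fun j _ => ?_
    rcases lt_or_ge j i with hij | hij
    · have := hLx j hij.ne
      rw [if_neg hij.not_gt] at this
      simp [b] at this
      simp [b, this]
    · exact mul_le_mul_of_nonneg_right (hT.eigenvalues_antitone hn hij) (sq_nonneg _)
  exact le_of_mul_le_mul_right (hS'.trans ((h x).trans hT')) (by positivity)

/-- The sum of the arctangents of the eigenvalues of an operator, with multiplicity. -/
def operatorPhase (T : E →L[ℝ] E) : ℝ :=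
  ((T : E →ₗ[ℝ] E).charpoly.roots.map Real.arctan).sum

theorem operatorPhase_eq_sum {n : ℕ} {T : E →L[ℝ] E} (hT : (T : E →ₗ[ℝ] E).IsSymmetric)
    (hn : Module.finrank ℝ E = n) :
    operatorPhase T = ∑ i, Real.arctan (hT.eigenvalues hn i) := by
  rw [operatorPhase, hT.roots_charpoly_eq_eigenvalues hn, Multiset.map_map]
  rfl

theorem operatorPhase_mono {S T : E →L[ℝ] E} (hS : (S : E →ₗ[ℝ] E).IsSymmetric)
    (hT : (T : E →ₗ[ℝ] E).IsSymmetric) (h : ∀ x, ⟪S x, x⟫ ≤ ⟪T x, x⟫) :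
    operatorPhase S ≤ operatorPhase T := by
  rw [operatorPhase_eq_sum hS rfl, operatorPhase_eq_sum hT rfl]
  exact Finset.sum_le_sum fun i _ =>
    Real.arctan_strictMono.monotone (hS.eigenvalues_le_of_le hT rfl h i)

/-- The characteristic polynomial is composed with X - c, so every root shifts by c. Continuity and
strict monotonicity along the identity follow termwise. -/
theorem operatorPhase_add_smul_id (T : E →L[ℝ] E) (c : ℝ) :
    operatorPhase (T + c • ContinuousLinearMap.id ℝ E) =
      ((T : E →ₗ[ℝ] E).charpoly.roots.map fun l => Real.arctan (l + c)).sum := by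
  have h : ((T + c • ContinuousLinearMap.id ℝ E : E →L[ℝ] E) : E →ₗ[ℝ] E)
      = (T : E →ₗ[ℝ] E) - (-c) • (1 : Module.End ℝ E) := by
    ext x; simp
  rw [operatorPhase, h, LinearMap.charpoly_sub_smul, 
    ← one_mul Polynomial.X, ← Polynomial.C_1, Polynomial.roots_comp_C_mul_X_add_C _ _ _ isUnit_one]
  simp [Multiset.map_map]

theorem operatorPhase_smul_id (c : ℝ) :
    operatorPhase (c • ContinuousLinearMap.id ℝ E) = Module.finrank ℝ E * Real.arctan c := by
  have := operatorPhase_add_smul_id (0 : E →L[ℝ] E) c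
  rw [zero_add] at this
  rw [this]
  simp [Multiset.map_nsmul, Multiset.sum_nsmul]

theorem continuous_operatorPhase_add_smul_id (T : E →L[ℝ] E) :
    Continuous fun c : ℝ => operatorPhase (T + c • ContinuousLinearMap.id ℝ E) := by
  simp_rw [operatorPhase_add_smul_id]
  exact continuous_multiset_sum _ fun l _ => Real.continuous_arctan.comp (by fun_prop)

theorem operatorPhase_lt_add_smul_id [Nontrivial E] {T : E →L[ℝ] E}
    (hT : (T : E →ₗ[ℝ] E).IsSymmetric) {c : ℝ} (hc : 0 < c) :
    operatorPhase T < operatorPhase (T + c • ContinuousLinearMap.id ℝ E) := by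
  rw [operatorPhase_add_smul_id, operatorPhase, hT.roots_charpoly_eq_eigenvalues rfl]
  rw [Multiset.map_map, Multiset.map_map]
  have : NeZero (Module.finrank ℝ E) := ⟨Module.finrank_pos.ne'⟩
  refine Finset.sum_lt_sum_of_nonempty Finset.univ_nonempty fun i _ => ?_
  simp only [Function.comp_apply]
  exact Real.arctan_strictMono (by simpa using hc)

end Phase

/-- The phase of the matrix of a symmetric operator in the standard basis. -/
theorem lagrangianPhase_of_inner {n : ℕ}
    {T : EuclideanSpace ℝ (Fin n) →L[ℝ] EuclideanSpace ℝ (Fin n)}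
    (hT : (T : EuclideanSpace ℝ (Fin n) →ₗ[ℝ] EuclideanSpace ℝ (Fin n)).IsSymmetric) :
    lagrangianPhase (Matrix.of fun i j =>
      ⟪T (EuclideanSpace.single i 1), EuclideanSpace.single j 1⟫) = operatorPhase T := by
  rw [lagrangianPhase, operatorPhase,
    ← LinearMap.charpoly_toMatrix (T : EuclideanSpace ℝ (Fin n) →ₗ[ℝ] EuclideanSpace ℝ (Fin n))
      (EuclideanSpace.basisFun (Fin n) ℝ).toBasis]
  congr 4
  ext i j
  have := hT (EuclideanSpace.single i 1) (EuclideanSpace.single j 1)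
  simp only [ContinuousLinearMap.coe_coe] at this
  simp only [Matrix.of_apply, this, LinearMap.toMatrix_apply]
  simp [EuclideanSpace.inner_single_left]

/-! ### Subgradient maps, second order expansions and contact points -/

section Semiconvex

variable {E : Type*} [NormedAddCommGroup E] [InnerProductSpace ℝ E]

/-- `a x` is a subgradient of `f` at `x`, for every `x`. -/
def IsSubgradientMap (f : E → ℝ) (a : E → E) : Prop :=
  ∀ x z, f x + ⟪a x, z - x⟫ ≤ f z

/-- The contact condition: `f + h - K/2 |·|²` lies below an affine function of slope `p` touching
it at `x`. -/
def IsContact (f h : E → ℝ) (K : ℝ) (p x : E) : Prop :=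
  ∀ z, f z + h z - K / 2 * ‖z‖ ^ 2 - ⟪p, z⟫ ≤ f x + h x - K / 2 * ‖x‖ ^ 2 - ⟪p, x⟫

theorem IsContact.symm {f h : E → ℝ} {K : ℝ} {p x : E} (hc : IsContact f h K p x) :
    IsContact h f K p x := fun z => by
  have := hc z
  linarith

/-- Cut [0, 1] into N equal steps: the increments add up to at most m/N, which tends to 0. This
replaces integration of a merely defined subgradient. -/
theorem sub_le_of_forall_sub_le_sq {g : ℝ → ℝ} {m : ℝ}
    (h : ∀ s t, 0 ≤ s → s ≤ t → t ≤ 1 → g t - g s ≤ m * (t - s) ^ 2) : g 1 ≤ g 0 := by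
  have key : ∀ N : ℕ, 0 < N → g 1 - g 0 ≤ m * (1 / (N : ℝ)) := by
    intro N hN
    have hN' : (0 : ℝ) < N := by exact_mod_cast hN
    have hind : ∀ k : ℕ, k ≤ N → g (k / N) - g 0 ≤ k * (m * (1 / (N : ℝ)) ^ 2) := by
      intro k
      induction k with
      | zero => intro _; simp
      | succ k ih =>
        intro hk
        have h1 := ih (by omega)
        have hk' : ((k + 1 : ℕ) : ℝ) ≤ N := by exact_mod_cast hk
        have h2 := h (k / N) ((k + 1 : ℕ) / N) (by positivity)
          (by gcongr; exact k.le_succ) ((div_le_one hN').2 hk')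
        have h3 : (((k + 1 : ℕ) : ℝ) / N - k / N) = 1 / N := by push_cast; ring
        rw [h3] at h2
        push_cast at h2 ⊢
        linarith
    have := hind N le_rfl
    rw [div_self hN'.ne'] at this
    refine this.trans (le_of_eq ?_)
    field_simp
  have hlim : Filter.Tendsto (fun N : ℕ => m * (1 / (N : ℝ))) Filter.atTop (𝓝 (m * 0)) :=
    (tendsto_one_div_atTop_nhds_zero_nat).const_mul m
  rw [mul_zero] at hlim
  have := ge_of_tendsto hlim (Filter.eventually_atTop.2 ⟨1, fun N hN => key N hN⟩)
  linarith

namespace IsSubgradientMap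

variable {f h : E → ℝ} {a b : E → E}

/-- A subgradient map that is differentiable at `x` yields a second order expansion at `x`. -/
theorem abs_expansion_le (hf : IsSubgradientMap f a) {x : E} {M : E →L[ℝ] E}
    (hM : HasFDerivAt a M x) {ε : ℝ} (hε : 0 < ε) :
    ∀ᶠ d in 𝓝 (0 : E), |f (x + d) - (f x + ⟪a x, d⟫ + 1 / 2 * ⟪M d, d⟫)| ≤ ε * ‖d‖ ^ 2 := by
  have h1 := (hasFDerivAt_iff_isLittleO_nhds_zero.1 hM).def hε
  obtain ⟨ρ, hρ, hball⟩ := Metric.eventually_nhds_iff_ball.1 h1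
  refine Metric.eventually_nhds_iff_ball.2 ⟨ρ, hρ, fun d hd => ?_⟩
  have hseg : ∀ t : ℝ, 0 ≤ t → t ≤ 1 →
      |⟪a (x + t • d), d⟫ - ⟪a x, d⟫ - t * ⟪M d, d⟫| ≤ ε * ‖d‖ ^ 2 := by
    intro t ht0 ht1
    have hn : ‖t • d‖ ≤ ‖d‖ := by
      rw [norm_smul, Real.norm_of_nonneg ht0]
      exact mul_le_of_le_one_left (norm_nonneg _) ht1
    have hmem : t • d ∈ Metric.ball (0 : E) ρ := by
      rw [mem_ball_zero_iff] at hd ⊢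
      exact hn.trans_lt hd
    have h2 := hball _ hmem
    have h3 : ⟪a (x + t • d), d⟫ - ⟪a x, d⟫ - t * ⟪M d, d⟫
        = ⟪a (x + t • d) - a x - M (t • d), d⟫ := by
      rw [inner_sub_left, inner_sub_left, map_smul, real_inner_smul_left]
    rw [h3]
    refine (abs_real_inner_le_norm _ _).trans ?_
    calc _ ≤ ε * ‖t • d‖ * ‖d‖ := by gcongr
      _ ≤ ε * ‖d‖ * ‖d‖ := by gcongr
      _ = _ := by ring
  set c := ⟪a x, d⟫
  set m := ⟪M d, d⟫
  set e := ε * ‖d‖ ^ 2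
  have hstep : ∀ s t : ℝ, f (x + t • d) - f (x + s • d) ≤ (t - s) * ⟪a (x + t • d), d⟫ := by
    intro s t
    have := hf (x + t • d) (x + s • d)
    have h4 : x + s • d - (x + t • d) = (s - t) • d := by rw [sub_smul]; abel
    rw [h4, real_inner_smul_right] at this
    linarith
  -- The subgradient is taken at the endpoint t, whereas the increment of t²m/2 corresponds to the
  -- midpoint; the mismatch is exactly m/2 (t - s)².
  have hup := sub_le_of_forall_sub_le_sq
    (g := fun t => f (x + t • d) - t * c - t ^ 2 / 2 * m - t * e) (m := m / 2) (by
      intro s t hs hst ht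
      have h5 := hstep s t
      have h6 := (abs_le.1 (hseg t (hs.trans hst) ht)).2
      have h7 := mul_le_mul_of_nonneg_left h6 (sub_nonneg.2 hst)
      nlinarith)
  have hlo := sub_le_of_forall_sub_le_sq
    (g := fun t => -f (x + t • d) + t * c + t ^ 2 / 2 * m - t * e) (m := m / 2) (by
      intro s t hs hst ht
      have h5 := hstep t s
      have h6 := (abs_le.1 (hseg s hs (hst.trans ht))).1
      have h7 := mul_le_mul_of_nonneg_left h6 (sub_nonneg.2 hst)
      nlinarith)
  simp only [one_smul, zero_smul, add_zero] at hup hlo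
  rw [abs_le]
  constructor <;> linarith

/-- Otherwise the difference e is a nonzero ascent direction: moving by te gains t|e|² and costs
only K/2 t²|e|², contradicting maximality for small t. -/
theorem slope_eq_of_isContact (hf : IsSubgradientMap f a) (hh : IsSubgradientMap h b) {K : ℝ}
    {p x : E} (hc : IsContact f h K p x) : p = a x + b x - K • x := by
  by_contra hne
  set e := a x + b x - K • x - p with he
  have he0 : 0 < ‖e‖ ^ 2 := by
    have : e ≠ 0 := fun h0 => hne (sub_eq_zero.1 h0).symm
    positivity
  have key : ∀ t : ℝ, t * ‖e‖ ^ 2 ≤ K / 2 * t ^ 2 * ‖e‖ ^ 2 := by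
    intro t
    have h1 := hc (x + t • e)
    have h2 := hf x (x + t • e)
    have h3 := hh x (x + t • e)
    rw [add_sub_cancel_left] at h2 h3
    have h4 : ‖x + t • e‖ ^ 2 = ‖x‖ ^ 2 + 2 * (t * ⟪x, e⟫) + t ^ 2 * ‖e‖ ^ 2 := by
      rw [norm_add_sq_real, norm_smul, real_inner_smul_right, mul_pow, Real.norm_eq_abs, sq_abs]
    have h5 : ‖e‖ ^ 2 = ⟪a x, e⟫ + ⟪b x, e⟫ - K * ⟪x, e⟫ - ⟪p, e⟫ := by
      rw [← real_inner_self_eq_norm_sq]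
      nth_rewrite 1 [he]
      simp only [inner_sub_left, inner_add_left, real_inner_smul_left]
    rw [h4, inner_add_right, real_inner_smul_right] at h1
    rw [real_inner_smul_right] at h2 h3
    have h6 : t * ‖e‖ ^ 2 = t * (⟪a x, e⟫ + ⟪b x, e⟫ - K * ⟪x, e⟫ - ⟪p, e⟫) := by rw [← h5]
    linarith
  have h1 := key (1 / (|K| + 1))
  have hK : 0 < |K| + 1 := by positivity
  rw [← sub_nonneg, ← sub_mul] at h1
  have h2 := nonneg_of_mul_nonneg_left h1 he0
  have h3 : K / 2 * (1 / (|K| + 1)) ^ 2 - 1 / (|K| + 1)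
      = (K / 2 - (|K| + 1)) * (1 / (|K| + 1)) ^ 2 := by field_simp
  rw [h3] at h2
  have h4 := nonneg_of_mul_nonneg_left h2 (by positivity)
  have := le_abs_self K
  have := abs_nonneg K
  linarith

/-- Contact bounds f + h above by a paraboloid; subtracting the affine minorant of h at x leaves one
for f alone. -/
theorem le_quadratic_of_isContact (hf : IsSubgradientMap f a) (hh : IsSubgradientMap h b) {K : ℝ}
    {p x : E} (hc : IsContact f h K p x) (z : E) :
    f z ≤ f x + ⟪a x, z - x⟫ + K / 2 * ‖z - x‖ ^ 2 := by
  have hp := slope_eq_of_isContact hf hh hc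
  have h1 := hc z
  have h2 := hh x z
  have h3 : ‖z‖ ^ 2 = ‖x‖ ^ 2 + 2 * ⟪x, z - x⟫ + ‖z - x‖ ^ 2 := by
    rw [← norm_add_sq_real, add_sub_cancel]
  have h4 : ⟪p, z⟫ = ⟪p, x⟫ + (⟪a x, z - x⟫ + ⟪b x, z - x⟫ - K * ⟪x, z - x⟫) := by
    have : ⟪p, z⟫ = ⟪p, x⟫ + ⟪p, z - x⟫ := by rw [← inner_add_right, add_sub_cancel]
    rw [this]
    nth_rewrite 2 [hp]
    simp only [inner_sub_left, inner_add_left, real_inner_smul_left]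
  rw [h3, h4] at h1
  linarith

/-- At y + K⁻¹(a y - a x) the affine minorant of f at y must stay below the paraboloid over x. Only
x is a contact point and y is arbitrary, which later extends differentiability from the contact set
to a full neighbourhood. -/
theorem norm_sub_le_of_isContact (hf : IsSubgradientMap f a) (hh : IsSubgradientMap h b) {K : ℝ}
    (hK : 0 < K) {p x : E} (hc : IsContact f h K p x) (y : E) :
    ‖a y - a x‖ ≤ 3 * K * ‖y - x‖ := by
  set e := a y - a x with he
  have h1 := le_quadratic_of_isContact hf hh hc (y + K⁻¹ • e)
  have h2 := hf y (y + K⁻¹ • e)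
  have h3 := hf x y
  rw [add_sub_cancel_left] at h2
  have h5 : y + K⁻¹ • e - x = (y - x) + K⁻¹ • e := by abel
  rw [h5, inner_add_right] at h1
  have h6 : ‖y - x + K⁻¹ • e‖ ≤ ‖y - x‖ + K⁻¹ * ‖e‖ := by
    refine (norm_add_le _ _).trans ?_
    rw [norm_smul, Real.norm_of_nonneg (by positivity)]
  have h7 : ⟪a y, K⁻¹ • e⟫ - ⟪a x, K⁻¹ • e⟫ = K⁻¹ * ‖e‖ ^ 2 := by
    rw [← inner_sub_left, ← he, real_inner_smul_right, real_inner_self_eq_norm_sq]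
  have h8 : ‖y - x + K⁻¹ • e‖ ^ 2 ≤ (‖y - x‖ + K⁻¹ * ‖e‖) ^ 2 := by gcongr
  have h9 : K⁻¹ * ‖e‖ ^ 2 ≤ K / 2 * (‖y - x‖ + K⁻¹ * ‖e‖) ^ 2 := by
    have := mul_le_mul_of_nonneg_left h8 (by positivity : 0 ≤ K / 2)
    linarith
  set r := K⁻¹ * ‖e‖ with hr
  have her : ‖e‖ = K * r := by rw [hr]; field_simp
  have hr0 : 0 ≤ r := by positivity
  have h10 : K * r ^ 2 ≤ K / 2 * (‖y - x‖ + r) ^ 2 := by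
    have : K⁻¹ * ‖e‖ ^ 2 = K * r ^ 2 := by rw [her]; field_simp
    rwa [this] at h9
  have h11 : r ^ 2 ≤ 1 / 2 * (‖y - x‖ + r) ^ 2 := by
    have : K * r ^ 2 ≤ K * (1 / 2 * (‖y - x‖ + r) ^ 2) := by linarith
    exact le_of_mul_le_mul_left this hK
  have h12 : r ≤ 3 * ‖y - x‖ := by
    by_contra hlt
    push Not at hlt
    nlinarith [norm_nonneg (y - x)]
  rw [her]
  nlinarith

end IsSubgradientMap

end Semiconvex

/-! ### Jensen's lemma via Rademacher's theorem and Lebesgue density -/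

section Contact

open MeasureTheory Measure

variable {E : Type*} [NormedAddCommGroup E] [InnerProductSpace ℝ E]

/-- Almost every point of a set `G` is approximated by points of `G` in all directions. -/
theorem ae_exists_mem_dist_le [FiniteDimensional ℝ E] [MeasurableSpace E] [BorelSpace E]
    (μ : Measure E) [μ.IsAddHaarMeasure] (G : Set E) :
    ∀ᵐ x ∂μ.restrict G, ∀ τ > 0, ∀ᶠ z in 𝓝[≠] x, ∃ y ∈ G, dist y z ≤ τ * dist z x := by
  have h : ∀ m : ℕ, ∀ᵐ x ∂μ.restrict G, ∀ᶠ z in 𝓝[≠] x,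
      ∃ y ∈ G, dist y z ≤ (1 / ((m : ℝ) + 1)) * dist z x := by
    intro m
    filter_upwards [IsUnifLocDoublingMeasure.ae_tendsto_measure_inter_div μ G (m + 1)] with x hx
    have hm : (0 : ℝ) < m + 1 := by positivity
    have hδ : Filter.Tendsto (fun z : E => 1 / ((m : ℝ) + 1) * dist z x) (𝓝[≠] x) (𝓝[>] 0) := by
      refine tendsto_nhdsWithin_iff.2 ⟨?_, ?_⟩
      · have : Continuous fun z : E => 1 / ((m : ℝ) + 1) * dist z x := by fun_prop
        simpa using (this.tendsto x).mono_left nhdsWithin_le_nhds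
      · filter_upwards [self_mem_nhdsWithin] with z hz
        have : 0 < dist z x := dist_pos.2 hz
        exact mem_Ioi.2 (by positivity)
    -- Density is used along balls centred at z, not at x: their radius is a fixed fraction of the
    -- distance to x, which the doubling version of the theorem allows. Density near 1 makes them
    -- meet G.
    have hlim := hx (fun z => z) _ hδ (by
      refine Filter.Eventually.of_forall fun z => ?_
      rw [Metric.mem_closedBall, dist_comm]
      apply le_of_eq
      field_simp)
    filter_upwards [hlim.eventually (lt_mem_nhds zero_lt_one)] with z hz
    have hne : (G ∩ Metric.closedBall z (1 / ((m : ℝ) + 1) * dist z x)).Nonempty := by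
      by_contra hemp
      rw [not_nonempty_iff_eq_empty] at hemp
      rw [hemp, measure_empty, ENNReal.zero_div] at hz
      exact lt_irrefl _ hz
    obtain ⟨y, hyG, hy⟩ := hne
    exact ⟨y, hyG, hy⟩
  filter_upwards [ae_all_iff.2 h] with x hx τ hτ
  obtain ⟨m, hm⟩ := exists_nat_one_div_lt hτ
  filter_upwards [hx m] with z ⟨y, hy, hyz⟩
  exact ⟨y, hy, hyz.trans (by gcongr)⟩

/-- A map that is differentiable along `G` at `x` and satisfies a Lipschitz bound between points of
`G` and arbitrary points is differentiable at `x`, if `G` approximates all points near `x`. -/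
theorem HasFDerivWithinAt.hasFDerivAt_of_forall_dist_le {a : E → E} {G : Set E} {C : ℝ}
    (hC : 0 ≤ C) (ha : ∀ x ∈ G, ∀ y, ‖a y - a x‖ ≤ C * ‖y - x‖) {x : E}
    {M : E →L[ℝ] E} (hM : HasFDerivWithinAt a M G x)
    (hG : ∀ τ > 0, ∀ᶠ z in 𝓝[≠] x, ∃ y ∈ G, dist y z ≤ τ * dist z x) : HasFDerivAt a M x := by
  rw [hasFDerivAt_iff_isLittleO]
  refine Asymptotics.IsLittleO.of_bound fun ε hε => ?_
  set τ := min 1 (ε / (2 * (C + ‖M‖ + 1))) with hτdef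
  have hτ : 0 < τ := by positivity
  have hτ1 : τ ≤ 1 := min_le_left _ _
  have hτ2 : τ * (C + ‖M‖) ≤ ε / 2 := by
    have : τ ≤ ε / (2 * (C + ‖M‖ + 1)) := min_le_right _ _
    calc τ * (C + ‖M‖) ≤ ε / (2 * (C + ‖M‖ + 1)) * (C + ‖M‖ + 1) :=
        mul_le_mul this (by linarith) (by positivity) (by positivity)
      _ = ε / 2 := by field_simp
  have h1 := (hasFDerivWithinAt_iff_isLittleO.1 hM).def (show 0 < ε / 4 by positivity)
  rw [eventually_nhdsWithin_iff] at h1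
  obtain ⟨ρ, hρ, hball⟩ := Metric.eventually_nhds_iff_ball.1 h1
  have h2 := hG τ hτ
  rw [eventually_nhdsWithin_iff] at h2
  filter_upwards [h2, Metric.ball_mem_nhds x (half_pos hρ)] with z hz hzρ
  by_cases hzx : z = x
  · simp [hzx]
  obtain ⟨y, hyG, hyz⟩ := hz hzx
  rw [dist_eq_norm, dist_eq_norm] at hyz
  have hzx' : ‖z - x‖ < ρ / 2 := by rwa [Metric.mem_ball, dist_eq_norm] at hzρ
  have hyz1 : ‖y - z‖ ≤ ‖z - x‖ := hyz.trans (mul_le_of_le_one_left (norm_nonneg _) hτ1)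
  have hyx : ‖y - x‖ ≤ 2 * ‖z - x‖ := by
    have := norm_add_le (y - z) (z - x)
    rw [sub_add_sub_cancel] at this
    linarith
  have h3 := hball y (by rw [Metric.mem_ball, dist_eq_norm]; linarith) hyG
  have h4 := ha y hyG z
  have h5 := M.le_opNorm (y - z)
  have h6 : a z - a x - M (z - x) = (a z - a y) + (a y - a x - M (y - x)) + M (y - z) := by
    simp only [map_sub]; abel
  rw [h6]
  calc _ ≤ ‖a z - a y‖ + ‖a y - a x - M (y - x)‖ + ‖M (y - z)‖ := norm_add₃_le
    _ ≤ C * ‖y - z‖ + ε / 4 * (2 * ‖z - x‖) + ‖M‖ * ‖y - z‖ := by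
      rw [norm_sub_rev z y] at h4
      gcongr
      exact h3.trans (by gcongr)
    _ = (C + ‖M‖) * ‖y - z‖ + ε / 2 * ‖z - x‖ := by ring
    _ ≤ (C + ‖M‖) * (τ * ‖z - x‖) + ε / 2 * ‖z - x‖ := by gcongr
    _ = τ * (C + ‖M‖) * ‖z - x‖ + ε / 2 * ‖z - x‖ := by ring
    _ ≤ ε / 2 * ‖z - x‖ + ε / 2 * ‖z - x‖ := by gcongr
    _ = ε * ‖z - x‖ := by ring

/-- Jensen's lemma: if all small slopes are contact slopes, then there is a contact point at which
both subgradient maps are differentiable. -/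
theorem IsSubgradientMap.exists_isContact_hasFDerivAt [FiniteDimensional ℝ E]
    {f h : E → ℝ} {a b : E → E}
    (hf : IsSubgradientMap f a) (hh : IsSubgradientMap h b) {K η : ℝ} (hK : 0 < K) (hη : 0 < η)
    (hsurj : ∀ p ∈ Metric.ball (0 : E) η, ∃ x, IsContact f h K p x) :
    ∃ p ∈ Metric.ball (0 : E) η, ∃ x, IsContact f h K p x ∧
      ∃ M N : E →L[ℝ] E, HasFDerivAt a M x ∧ HasFDerivAt b N x := by
  let _ : MeasurableSpace E := borel E
  have _ : BorelSpace E := ⟨rfl⟩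
  set G : Set E := {x | ∃ p ∈ Metric.ball (0 : E) η, IsContact f h K p x} with hG
  have ha : ∀ x ∈ G, ∀ y, ‖a y - a x‖ ≤ 3 * K * ‖y - x‖ := by
    rintro x ⟨p, -, hp⟩ y
    exact hf.norm_sub_le_of_isContact hh hK hp y
  have hb : ∀ x ∈ G, ∀ y, ‖b y - b x‖ ≤ 3 * K * ‖y - x‖ := by
    rintro x ⟨p, -, hp⟩ y
    exact hh.norm_sub_le_of_isContact hf hK hp.symm y
  have hKnn : ((3 * K).toNNReal : ℝ) = 3 * K := Real.coe_toNNReal _ (by positivity)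
  have hLa : LipschitzOnWith (3 * K).toNNReal a G :=
    LipschitzOnWith.of_dist_le_mul fun x _ y hy => by
      rw [dist_eq_norm, dist_eq_norm, hKnn]; exact ha y hy x
  have hLb : LipschitzOnWith (3 * K).toNNReal b G :=
    LipschitzOnWith.of_dist_le_mul fun x _ y hy => by
      rw [dist_eq_norm, dist_eq_norm, hKnn]; exact hb y hy x
  set μ : Measure E := μH[Module.finrank ℝ E]
  -- This map recovers the slope p from a contact point, so it sends G onto a set containing a ball;
  -- being Lipschitz, it could not do so if G were null.
  have hL : LipschitzOnWith (7 * K).toNNReal (fun x => a x + b x - K • x) G := by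
    refine LipschitzOnWith.of_dist_le_mul fun x _ y hy => ?_
    rw [dist_eq_norm, dist_eq_norm, Real.coe_toNNReal _ (by positivity)]
    have h1 : a x + b x - K • x - (a y + b y - K • y) = (a x - a y) + (b x - b y) - K • (x - y) := by
      rw [smul_sub]; abel
    rw [h1]
    have h2 := norm_sub_le ((a x - a y) + (b x - b y)) (K • (x - y))
    have h3 := norm_add_le (a x - a y) (b x - b y)
    rw [norm_smul, Real.norm_of_nonneg hK.le] at h2
    linarith [ha y hy x, hb y hy x]
  have himg : Metric.ball (0 : E) η ⊆ (fun x => a x + b x - K • x) '' G := by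
    intro p hp
    obtain ⟨x, hx⟩ := hsurj p hp
    exact ⟨x, ⟨p, hp, hx⟩, (hf.slope_eq_of_isContact hh hx).symm⟩
  have hpos : μ G ≠ 0 := by
    intro h0
    have h1 := hL.hausdorffMeasure_image_le (d := Module.finrank ℝ E) (by positivity)
    have h2 : μ ((fun x => a x + b x - K • x) '' G) = 0 := by
      refine le_antisymm (h1.trans ?_) zero_le
      change _ * μ G ≤ 0
      rw [h0, mul_zero]
    have h3 := measure_mono_null himg h2
    exact (Metric.measure_ball_pos μ 0 hη).ne' h3
  have hae : ∀ᵐ x ∂μ.restrict G, (DifferentiableWithinAt ℝ a G x ∨ x ∉ G) ∧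
      (DifferentiableWithinAt ℝ b G x ∨ x ∉ G) ∧
      ∀ τ > 0, ∀ᶠ z in 𝓝[≠] x, ∃ y ∈ G, dist y z ≤ τ * dist z x := by
    filter_upwards [ae_restrict_of_ae hLa.ae_differentiableWithinAt_of_mem,
      ae_restrict_of_ae hLb.ae_differentiableWithinAt_of_mem, ae_exists_mem_dist_le μ G]
      with x h1 h2 h3
    exact ⟨or_iff_not_imp_right.2 fun h => h1 (not_not.1 h),
      or_iff_not_imp_right.2 fun h => h2 (not_not.1 h), h3⟩
  obtain ⟨x, hxG, h1, h2, h3⟩ : ∃ x ∈ G, (DifferentiableWithinAt ℝ a G x ∨ x ∉ G) ∧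
      (DifferentiableWithinAt ℝ b G x ∨ x ∉ G) ∧
      ∀ τ > 0, ∀ᶠ z in 𝓝[≠] x, ∃ y ∈ G, dist y z ≤ τ * dist z x := by
    by_contra hcon
    apply hpos
    refine le_antisymm (le_trans ?_ (ae_iff.1 hae).le) zero_le
    refine le_trans (measure_mono ?_) (le_restrict_apply G _)
    exact fun x hx => ⟨fun hx' => hcon ⟨x, hx, hx'⟩, hx⟩
  obtain ⟨p, hp, hpx⟩ := id hxG
  have hM := (h1.resolve_right (not_not.2 hxG)).hasFDerivWithinAt
  have hN := (h2.resolve_right (not_not.2 hxG)).hasFDerivWithinAt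
  exact ⟨p, hp, x, hpx, _, _, hM.hasFDerivAt_of_forall_dist_le (by positivity) ha h3,
    hN.hasFDerivAt_of_forall_dist_le (by positivity) hb h3⟩

end Contact

/-! ### Sup-convolutions and the theorem on sums -/

section Sums

/-- Near the diagonal, the sum `U y + V z` with `y` or `z` outside `Ω` is below the level `θ`. -/
theorem exists_dist_le_imp_add_lt {X : Type*} [MetricSpace X]
    {K Ω : Set X} (hK : IsCompact K) (hΩ : IsOpen Ω)
    {U V : X → ℝ} (hU : UpperSemicontinuousOn U K) (hV : UpperSemicontinuousOn V K) {θ : ℝ}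
    (hbd : ∀ x ∈ K \ Ω, U x + V x < θ) :
    ∃ r > 0, ∀ y ∈ K, ∀ z ∈ K, dist y z ≤ r → θ ≤ U y + V z → y ∈ Ω ∧ z ∈ Ω := by
  set C : Set (X × X) := (K \ Ω) ×ˢ K ∪ K ×ˢ (K \ Ω) with hC
  have hCc : IsCompact C := ((hK.diff hΩ).prod hK).union (hK.prod (hK.diff hΩ))
  have hC1 : MapsTo Prod.fst C K := by
    rintro ⟨y, z⟩ (h | h)
    · exact h.1.1
    · exact h.1
  have hC2 : MapsTo Prod.snd C K := by
    rintro ⟨y, z⟩ (h | h)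
    · exact h.2
    · exact h.2.1
  have husc : UpperSemicontinuousOn (fun q : X × X => U q.1 + V q.2) C :=
    (hU.comp continuousOn_fst hC1).add (hV.comp continuousOn_snd hC2)
  have hD := husc.isCompact_inter_preimage_Ici hCc θ
  set D := C ∩ (fun q : X × X => U q.1 + V q.2) ⁻¹' Ici θ
  have hpos : ∀ q ∈ D, 0 < dist q.1 q.2 := by
    rintro ⟨y, z⟩ ⟨hq, hθ⟩
    refine dist_pos.2 fun heq => ?_
    simp only at heq
    subst heq
    have hy : y ∈ K \ Ω := by
      rcases hq with h | h
      · exact h.1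
      · exact h.2
    exact absurd (hbd y hy) (not_lt.2 hθ)
  -- `D`, the pairs at level at least θ with a component off Ω, is compact and misses the diagonal.
  obtain ⟨r, hr, hrD⟩ : ∃ r > 0, ∀ q ∈ D, r < dist q.1 q.2 := by
    rcases D.eq_empty_or_nonempty with hemp | hne
    · exact ⟨1, one_pos, by simp [hemp]⟩
    · obtain ⟨q, hq, hmin⟩ := hD.exists_isMinOn hne continuous_dist.continuousOn
      refine ⟨dist q.1 q.2 / 2, half_pos (hpos q hq), fun q' hq' => ?_⟩
      have := hmin hq'
      simp only [mem_ofPred_eq] at this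
      linarith [hpos q hq]
  refine ⟨r, hr, fun y hy z hz hyz hθ => ?_⟩
  by_contra hcon
  have hq : (y, z) ∈ D := by
    refine ⟨?_, hθ⟩
    by_cases hyΩ : y ∈ Ω
    · exact Or.inr ⟨hy, hz, fun hzΩ => hcon ⟨hyΩ, hzΩ⟩⟩
    · exact Or.inl ⟨⟨hy, hyΩ⟩, hz⟩
  exact absurd (hrD _ hq) (not_lt.2 hyz)

variable {E : Type*} [NormedAddCommGroup E] [InnerProductSpace ℝ E]

/-- The quadratic polynomial at `x` with gradient `b` and Hessian `T` touches `u` from above at `x`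
(up to adding `u x`). -/
def IsSuperjet (u : E → ℝ) (x b : E) (T : E →L[ℝ] E) : Prop :=
  ∀ᶠ y in 𝓝 x, u y ≤ u x + ⟪b, y - x⟫ + 1 / 2 * ⟪T (y - x), y - x⟫

/-- The derivative of a subgradient map is not known to be symmetric, but only its quadratic form
enters the jets. -/
theorem exists_isSymmetric_inner_eq [FiniteDimensional ℝ E] (M : E →L[ℝ] E) :
    ∃ A : E →L[ℝ] E, (A : E →ₗ[ℝ] E).IsSymmetric ∧ ∀ d, ⟪A d, d⟫ = ⟪M d, d⟫ := by
  have := FiniteDimensional.complete ℝ E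
  refine ⟨(1 / 2 : ℝ) • (M + ContinuousLinearMap.adjoint M), ?_, ?_⟩
  · intro x y
    simp only [ContinuousLinearMap.coe_coe, _root_.smul_apply,
      _root_.add_apply, real_inner_smul_left, real_inner_smul_right, inner_add_left,
      inner_add_right, ContinuousLinearMap.adjoint_inner_left,
      ContinuousLinearMap.adjoint_inner_right]
    ring
  · intro d
    simp only [_root_.smul_apply, _root_.add_apply, real_inner_smul_left,
      inner_add_left, ContinuousLinearMap.adjoint_inner_left, real_inner_comm (M d) d]
    ring

theorem isSymmetric_add_smul_id {T : E →L[ℝ] E} (hT : (T : E →ₗ[ℝ] E).IsSymmetric) (c : ℝ) :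
    ((T + c • ContinuousLinearMap.id ℝ E : E →L[ℝ] E) : E →ₗ[ℝ] E).IsSymmetric := by
  intro x y
  have := hT x y
  simp only [ContinuousLinearMap.coe_coe] at this
  simp [inner_add_left, inner_add_right, real_inner_smul_left, real_inner_smul_right, this]

theorem inner_add_smul_id (T : E →L[ℝ] E) (c : ℝ) (d : E) :
    ⟪(T + c • ContinuousLinearMap.id ℝ E) d, d⟫ = ⟪T d, d⟫ + c * ‖d‖ ^ 2 := by
  simp [inner_add_left, real_inner_smul_left]

theorem isSymmetric_neg {T : E →L[ℝ] E} (hT : (T : E →ₗ[ℝ] E).IsSymmetric) :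
    ((-T : E →L[ℝ] E) : E →ₗ[ℝ] E).IsSymmetric := by
  intro x y
  have := hT x y
  simpa using this

/-- The sup-convolution of `U`, up to a quadratic term, with the map of its maximizers. -/
theorem UpperSemicontinuousOn.exists_legendre {K : Set E} (hK : IsCompact K) (hne : K.Nonempty)
    {U : E → ℝ} (hU : UpperSemicontinuousOn U K) (k : ℝ) :
    ∃ (f : E → ℝ) (y : E → E), (∀ x, y x ∈ K) ∧
      (∀ x, f x = U (y x) - k / 2 * ‖y x - x‖ ^ 2 + k / 2 * ‖x‖ ^ 2) ∧
      (∀ x, ∀ z ∈ K, U z - k / 2 * ‖z - x‖ ^ 2 + k / 2 * ‖x‖ ^ 2 ≤ f x) ∧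
      IsSubgradientMap f fun x => k • y x := by
  have hmax : ∀ x, ∃ y ∈ K, ∀ z ∈ K,
      U z + (-(k / 2 * ‖z - x‖ ^ 2)) ≤ U y + (-(k / 2 * ‖y - x‖ ^ 2)) := by
    intro x
    have hc : Continuous fun z : E => -(k / 2 * ‖z - x‖ ^ 2) := by fun_prop
    exact (hU.add (hc.upperSemicontinuous.upperSemicontinuousOn K)).exists_isMaxOn hne hK
  choose y hyK hy using hmax
  refine ⟨fun x => U (y x) - k / 2 * ‖y x - x‖ ^ 2 + k / 2 * ‖x‖ ^ 2, y, hyK, fun _ => rfl,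
    fun x z hz => ?_, fun x z => ?_⟩
  · linarith [hy x z hz]
  -- Expanding the square, f is a supremum of the affine functions x ↦ U z - k/2 |z|² + k⟪z, x⟫, so
  -- k times a maximizer is a subgradient.
  · have h1 := hy z (y x) (hyK x)
    have h2 : ‖y x - x‖ ^ 2 = ‖y x‖ ^ 2 - 2 * ⟪y x, x⟫ + ‖x‖ ^ 2 := norm_sub_sq_real _ _
    have h3 : ‖y x - z‖ ^ 2 = ‖y x‖ ^ 2 - 2 * ⟪y x, z⟫ + ‖z‖ ^ 2 := norm_sub_sq_real _ _
    rw [h3] at h1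
    simp only [h2, real_inner_smul_left, inner_sub_right]
    linarith

theorem IsSubgradientMap.continuous {f : E → ℝ} {a : E → E} (hf : IsSubgradientMap f a) {C : ℝ}
    (ha : ∀ x, ‖a x‖ ≤ C) : Continuous f := by
  have hC : 0 ≤ C := (norm_nonneg _).trans (ha 0)
  have key : ∀ x z, f x - f z ≤ C * dist x z := by
    intro x z
    have h1 := hf x z
    have h2 := (abs_le.1 (abs_real_inner_le_norm (a x) (z - x))).1
    have h3 : ‖a x‖ * ‖z - x‖ ≤ C * ‖z - x‖ := by gcongr; exact ha x
    rw [dist_eq_norm, norm_sub_rev]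
    linarith
  refine (LipschitzWith.of_dist_le_mul (K := C.toNNReal) fun x z => ?_).continuous
  rw [Real.coe_toNNReal _ hC, Real.dist_eq, abs_le]
  have := key z x
  rw [dist_comm] at this
  exact ⟨by linarith, key x z⟩

/-- Second order expansion of the sup-convolution gives a superjet at the maximizer. -/
theorem isSuperjet_of_legendre {K Ω : Set E} (hΩ : IsOpen Ω) (hΩK : Ω ⊆ K) {U f : E → ℝ}
    {y : E → E} {k : ℝ}
    (hfy : ∀ x, f x = U (y x) - k / 2 * ‖y x - x‖ ^ 2 + k / 2 * ‖x‖ ^ 2)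
    (hfz : ∀ x, ∀ z ∈ K, U z - k / 2 * ‖z - x‖ ^ 2 + k / 2 * ‖x‖ ^ 2 ≤ f x)
    (hf : IsSubgradientMap f fun x => k • y x) {x : E} (hx : y x ∈ Ω) {M A : E →L[ℝ] E}
    (hM : HasFDerivAt (fun x => k • y x) M x) (hA : ∀ d, ⟪A d, d⟫ = ⟪M d, d⟫) {ε : ℝ}
    (hε : 0 < ε) :
    IsSuperjet U (y x) (k • (y x - x))
      (A + (-k) • ContinuousLinearMap.id ℝ E + ε • ContinuousLinearMap.id ℝ E) := by
  have h1 := hf.abs_expansion_le hM (half_pos hε)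
  have ht : Filter.Tendsto (fun z => z - y x) (𝓝 (y x)) (𝓝 0) := by
    have : Continuous fun z => z - y x := by fun_prop
    simpa using this.tendsto (y x)
  filter_upwards [ht.eventually h1, hΩ.mem_nhds hx] with z hz hzΩ
  -- Base point and competitor are translated together, so the penalty |y x - x|² is unchanged and
  -- the expansion of f at x becomes a bound for U at `y x`.
  have h2 := hfz (x + (z - y x)) z (hΩK hzΩ)
  have h3 := hfy x
  have h4 := (abs_le.1 hz).2
  set d := z - y x with hd
  have h5 : z - (x + d) = y x - x := by rw [hd]; abel
  have h6 : ‖x + d‖ ^ 2 = ‖x‖ ^ 2 + 2 * ⟪x, d⟫ + ‖d‖ ^ 2 := norm_add_sq_real _ _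
  rw [h5, h6] at h2
  rw [inner_add_smul_id, inner_add_smul_id, hA, real_inner_smul_left, inner_sub_left]
  rw [real_inner_smul_left] at h4
  linarith

/-- Since s - s² ≤ 1, the linear term is absorbed by the leading 1, leaving (1 + 4/r²)(s² + s'²) ≤
1. This is what fixes the size of the penalty k below. -/
theorem le_half_of_mul_sq_add_sq_le {s s' r Q : ℝ} (hs : 0 ≤ s) (hs' : 0 ≤ s') (hr : 0 < r)
    (hQ : 0 < Q) (h : (1 + Q * (1 + 4 / r ^ 2)) * (s ^ 2 + s' ^ 2) ≤ Q - 1 + s) :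
    s ≤ 1 ∧ s ≤ r / 2 ∧ s' ≤ r / 2 := by
  set w := s ^ 2 + s' ^ 2 with hw
  have hsw : s ^ 2 ≤ w := le_add_of_nonneg_right (sq_nonneg _)
  have hsw' : s' ^ 2 ≤ w := le_add_of_nonneg_left (sq_nonneg _)
  have hw0 : 0 ≤ w := (sq_nonneg s).trans hsw
  have h1 : Q * ((1 + 4 / r ^ 2) * w) ≤ Q * 1 := by nlinarith [sq_nonneg (s - 1)]
  have h2 := le_of_mul_le_mul_left h1 hQ
  have h3 : 0 ≤ 4 / r ^ 2 * w := by positivity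
  have h4 : w ≤ (r / 2) ^ 2 := by
    have : 4 / r ^ 2 * w ≤ 1 := by linarith
    rw [div_mul_eq_mul_div, div_le_one (by positivity)] at this
    linarith
  exact ⟨(sq_le_one_iff₀ hs).1 (by linarith), (sq_le_sq₀ hs (by positivity)).1 (hsw.trans h4),
    (sq_le_sq₀ hs' (by positivity)).1 (hsw'.trans h4)⟩

/-- At a contact point, the Hessian of `f + h` is at most `K`. -/
theorem IsContact.inner_add_inner_le {f h : E → ℝ} {a b : E → E} (hf : IsSubgradientMap f a)
    (hh : IsSubgradientMap h b) {K : ℝ} {p x : E} (hc : IsContact f h K p x) {M N : E →L[ℝ] E}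
    (hM : HasFDerivAt a M x) (hN : HasFDerivAt b N x) (d : E) :
    ⟪M d, d⟫ + ⟪N d, d⟫ ≤ K * ‖d‖ ^ 2 := by
  refine le_of_forall_pos_le_add fun ε hε => ?_
  set ε' := ε / (4 * (‖d‖ ^ 2 + 1)) with hε'
  have hε'0 : 0 < ε' := by positivity
  have h1 := hf.abs_expansion_le hM hε'0
  have h2 := hh.abs_expansion_le hN hε'0
  obtain ⟨ρ, hρ, hball⟩ := Metric.eventually_nhds_iff_ball.1 (h1.and h2)
  set τ := ρ / (2 * (‖d‖ + 1)) with hτ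
  have hτ0 : 0 < τ := by positivity
  have hmem : τ • d ∈ Metric.ball (0 : E) ρ := by
    rw [mem_ball_zero_iff, norm_smul, Real.norm_of_nonneg hτ0.le]
    calc τ * ‖d‖ ≤ τ * (‖d‖ + 1) := by gcongr; linarith
      _ = ρ / 2 := by rw [hτ]; field_simp
      _ < ρ := by linarith
  obtain ⟨h3, h4⟩ := hball _ hmem
  have h3 := (abs_le.1 h3).1
  have h4 := (abs_le.1 h4).1
  have h5 := hc (x + τ • d)
  have hpe := hf.slope_eq_of_isContact hh hc
  have h6 : ⟪p, x + τ • d⟫ = ⟪p, x⟫ +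
      (⟪a x, τ • d⟫ + ⟪b x, τ • d⟫ - K * ⟪x, τ • d⟫) := by
    rw [inner_add_right]
    nth_rewrite 2 [hpe]
    simp only [inner_sub_left, inner_add_left, real_inner_smul_left]
  have h7 : ‖x + τ • d‖ ^ 2 = ‖x‖ ^ 2 + 2 * ⟪x, τ • d⟫ + ‖τ • d‖ ^ 2 := norm_add_sq_real _ _
  have h8 : ‖τ • d‖ ^ 2 = τ ^ 2 * ‖d‖ ^ 2 := by
    rw [norm_smul, mul_pow, Real.norm_eq_abs, sq_abs]
  have h9 : ∀ L : E →L[ℝ] E, ⟪L (τ • d), τ • d⟫ = τ ^ 2 * ⟪L d, d⟫ := by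
    intro L
    rw [map_smul, real_inner_smul_left, real_inner_smul_right]; ring
  rw [h6, h7, h8] at h5
  rw [h8, h9] at h3 h4
  have h10 : τ ^ 2 * (⟪M d, d⟫ + ⟪N d, d⟫ - K * ‖d‖ ^ 2) ≤
      τ ^ 2 * (4 * ε' * ‖d‖ ^ 2) := by linarith
  have h11 := le_of_mul_le_mul_left h10 (by positivity)
  have h12 : 4 * ε' * ‖d‖ ^ 2 ≤ ε := by
    calc 4 * ε' * ‖d‖ ^ 2 ≤ 4 * ε' * (‖d‖ ^ 2 + 1) := by gcongr; linarith
      _ = ε := by rw [hε']; field_simp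
  linarith

/-- Theorem on sums: if `U + V` has an interior maximum, there are second order superjets of `U` and
`V` at interior points whose Hessians have nonpositive sum. -/
theorem exists_isSuperjet_add_nonpos [FiniteDimensional ℝ E] {K Ω : Set E} (hK : IsCompact K)
    (hΩ : IsOpen Ω) (hΩK : Ω ⊆ K) {U V : E → ℝ} (hU : UpperSemicontinuousOn U K)
    (hV : UpperSemicontinuousOn V K) {z₀ : E} (hz₀ : z₀ ∈ K) {θ : ℝ}
    (hbd : ∀ x ∈ K \ Ω, U x + V x < θ) (hθ : θ < U z₀ + V z₀) :
    ∃ x ∈ Ω, ∃ y ∈ Ω, ∃ b c : E, ∃ A B : E →L[ℝ] E,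
      (A : E →ₗ[ℝ] E).IsSymmetric ∧ (B : E →ₗ[ℝ] E).IsSymmetric ∧
      (∀ ε : ℝ, 0 < ε → IsSuperjet U x b (A + ε • ContinuousLinearMap.id ℝ E)) ∧
      (∀ ε : ℝ, 0 < ε → IsSuperjet V y c (B + ε • ContinuousLinearMap.id ℝ E)) ∧
      ∀ d, ⟪A d, d⟫ + ⟪B d, d⟫ ≤ 0 := by
  have hne : K.Nonempty := ⟨z₀, hz₀⟩
  obtain ⟨r, hr, hrK⟩ := exists_dist_le_imp_add_lt hK hΩ hU hV hbd
  obtain ⟨R, hR, hRK⟩ := hK.isBounded.exists_pos_norm_le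
  obtain ⟨C, hC⟩ := hU.bddAbove_of_isCompact hK
  obtain ⟨C', hC'⟩ := hV.bddAbove_of_isCompact hK
  have hCK : ∀ x ∈ K, U x ≤ C := fun x hx => hC (mem_image_of_mem U hx)
  have hCK' : ∀ x ∈ K, V x ≤ C' := fun x hx => hC' (mem_image_of_mem V hx)
  set θ₀ := U z₀ + V z₀ with hθ₀
  -- Tilting by a slope shorter than η costs at most η(2R + 1), so values stay above θ.
  set η := min 1 ((θ₀ - θ) / (2 * R + 1)) with hη
  have hη0 : 0 < η := lt_min one_pos (div_pos (by linarith) (by positivity))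
  have hη1 : η ≤ 1 := min_le_left _ _
  have hη2 : η * (2 * R + 1) ≤ θ₀ - θ := by
    have := min_le_right 1 ((θ₀ - θ) / (2 * R + 1))
    rwa [← hη, le_div_iff₀ (by positivity)] at this
  set Q := C + C' - θ₀ + 2 * R + 1 with hQ
  have hQ0 : 0 < Q := by linarith [hCK z₀ hz₀, hCK' z₀ hz₀]
  set t := 1 + 4 / r ^ 2 with ht
  have ht0 : 0 < t := by positivity
  set k := 2 * (1 + Q * t) with hk
  have hk0 : 0 < k := by positivity
  obtain ⟨f, y, hyK, hfy, hfz, hf⟩ := hU.exists_legendre hK hne k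
  obtain ⟨h, y', hyK', hhy, hhz, hh⟩ := hV.exists_legendre hK hne k
  -- Any x doing at least as well as z₀ is confined, with close maximizers at a level above θ. The
  -- contact constant is 2k because each of f and h carries its own k/2 |x|².
  have hest : ∀ p ∈ Metric.ball (0 : E) η, ∀ x,
      f z₀ + h z₀ - (2 * k) / 2 * ‖z₀‖ ^ 2 - ⟪p, z₀⟫ ≤
        f x + h x - (2 * k) / 2 * ‖x‖ ^ 2 - ⟪p, x⟫ →
      ‖x‖ ≤ R + 1 ∧ dist (y x) (y' x) ≤ r ∧ θ ≤ U (y x) + V (y' x) := by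
    intro p hp x hx
    rw [mem_ball_zero_iff] at hp
    have h1 := hfz z₀ z₀ hz₀
    have h2 := hhz z₀ z₀ hz₀
    rw [sub_self, norm_zero] at h1 h2
    have h3 : ⟪p, z₀⟫ ≤ η * R := (real_inner_le_norm _ _).trans
      (mul_le_mul hp.le (hRK _ hz₀) (norm_nonneg _) hη0.le)
    set s := ‖y x - x‖ with hs
    set s' := ‖y' x - x‖ with hs'
    have hxs : ‖x‖ ≤ R + s := by
      have := norm_sub_le (y x) (y x - x)
      rw [sub_sub_cancel] at this
      linarith [hRK _ (hyK x)]
    have h4 : -(η * (R + s)) ≤ ⟪p, x⟫ :=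
      (neg_le_neg (mul_le_mul hp.le hxs (norm_nonneg _) hη0.le)).trans
        (abs_le.1 (abs_real_inner_le_norm p x)).1
    have h5 := hfy x
    have h6 := hhy x
    have h7 := hCK _ (hyK x)
    have h8 := hCK' _ (hyK' x)
    have h9 : k / 2 * s ^ 2 + k / 2 * s' ^ 2 ≤
        U (y x) + V (y' x) - θ₀ + η * R + η * (R + s) := by linarith
    have hs0 : 0 ≤ s := norm_nonneg _
    have hs0' : 0 ≤ s' := norm_nonneg _
    have h10 : η * R + η * (R + s) ≤ 2 * R + s := by
      have := mul_le_mul_of_nonneg_right hη1 (by positivity : 0 ≤ R + (R + s))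
      linarith
    have h11 : (1 + Q * t) * (s ^ 2 + s' ^ 2) ≤ Q - 1 + s := by
      have : k / 2 = 1 + Q * t := by rw [hk]; ring
      rw [this] at h9
      linarith
    obtain ⟨hs1, hsr, hsr'⟩ := le_half_of_mul_sq_add_sq_le hs0 hs0' hr hQ0 h11
    refine ⟨by linarith, ?_, ?_⟩
    · have := dist_triangle_right (y x) (y' x) x
      rw [dist_eq_norm (y x) x, dist_eq_norm (y' x) x] at this
      linarith
    · have h16 : 0 ≤ k / 2 * s ^ 2 + k / 2 * s' ^ 2 := by positivity
      have h17 : η * s ≤ η * 1 := by gcongr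
      linarith
  have hcont : Continuous f := hf.continuous (C := k * R) fun x => by
    rw [norm_smul, Real.norm_of_nonneg hk0.le]
    gcongr
    exact hRK _ (hyK x)
  have hcont' : Continuous h := hh.continuous (C := k * R) fun x => by
    rw [norm_smul, Real.norm_of_nonneg hk0.le]
    gcongr
    exact hRK _ (hyK' x)
  have hsurj : ∀ p ∈ Metric.ball (0 : E) η, ∃ x, IsContact f h (2 * k) p x := by
    intro p hp
    refine Continuous.exists_forall_ge' (by fun_prop) z₀ ?_
    have := FiniteDimensional.proper ℝ E
    filter_upwards [(isCompact_closedBall (0 : E) (R + 1)).compl_mem_cocompact] with x hx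
    by_contra hlt
    exact hx (mem_closedBall_zero_iff.2 (hest p hp x (not_le.1 hlt).le).1)
  obtain ⟨p, hp, x, hc, M, N, hM, hN⟩ :=
    hf.exists_isContact_hasFDerivAt hh (by positivity) hη0 hsurj
  obtain ⟨-, hdist, hlev⟩ := hest p hp x (hc z₀)
  obtain ⟨hyΩ, hyΩ'⟩ := hrK _ (hyK x) _ (hyK' x) hdist hlev
  obtain ⟨A, hA, hAM⟩ := exists_isSymmetric_inner_eq M
  obtain ⟨B, hB, hBN⟩ := exists_isSymmetric_inner_eq N
  have hJ := fun ε (hε : (0 : ℝ) < ε) =>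
    isSuperjet_of_legendre hΩ hΩK hfy hfz hf hyΩ hM hAM hε
  have hJ' := fun ε (hε : (0 : ℝ) < ε) =>
    isSuperjet_of_legendre hΩ hΩK hhy hhz hh hyΩ' hN hBN hε
  refine ⟨y x, hyΩ, y' x, hyΩ', k • (y x - x), k • (y' x - x),
    A + (-k) • ContinuousLinearMap.id ℝ E, B + (-k) • ContinuousLinearMap.id ℝ E,
    isSymmetric_add_smul_id hA _, isSymmetric_add_smul_id hB _, hJ, hJ', fun d => ?_⟩
  rw [inner_add_smul_id, inner_add_smul_id, hAM, hBN]
  linarith [hc.inner_add_inner_le hf hh hM hN d]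

end Sums

/-! ### Solutions tested by quadratic polynomials -/

section Jets

variable {E : Type*} [NormedAddCommGroup E] [InnerProductSpace ℝ E]

/-- `u` satisfies `F(D²u) ≥ ψ` in `Ω`, tested with quadratic polynomials touching from above. -/
def IsJetSubsolution [FiniteDimensional ℝ E] (Ω : Set E) (ψ : ℝ) (u : E → ℝ) : Prop :=
  ∀ x ∈ Ω, ∀ (b : E) (T : E →L[ℝ] E), (T : E →ₗ[ℝ] E).IsSymmetric →
    IsSuperjet u x b T → ψ ≤ operatorPhase T

/-- `v` satisfies `F(D²v) ≤ ψ` in `Ω`, tested with quadratic polynomials touching from below. -/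
def IsJetSupersolution [FiniteDimensional ℝ E] (Ω : Set E) (ψ : ℝ) (v : E → ℝ) : Prop :=
  ∀ x ∈ Ω, ∀ (b : E) (T : E →L[ℝ] E), (T : E →ₗ[ℝ] E).IsSymmetric →
    IsSuperjet (fun y => -v y) x b T → operatorPhase (-T) ≤ ψ

/-- The quadratic polynomial at `x₀` with value `c`, gradient `b` and Hessian `T`. -/
def quadraticAt (x₀ : E) (c : ℝ) (b : E) (T : E →L[ℝ] E) (x : E) : ℝ :=
  c + ⟪b, x - x₀⟫ + 1 / 2 * ⟪T (x - x₀), x - x₀⟫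

theorem quadraticAt_self (x₀ : E) (c : ℝ) (b : E) (T : E →L[ℝ] E) :
    quadraticAt x₀ c b T x₀ = c := by
  simp [quadraticAt]

theorem contDiff_quadraticAt (x₀ : E) (c : ℝ) (b : E) (T : E →L[ℝ] E) :
    ContDiff ℝ 2 (quadraticAt x₀ c b T) := by
  have h1 : ContDiff ℝ 2 fun x : E => x - x₀ := contDiff_id.sub contDiff_const
  exact (contDiff_const.add (contDiff_const.inner ℝ h1)).add
    (contDiff_const.mul ((T.contDiff.comp h1).inner ℝ h1))

theorem continuous_quadraticAt (x₀ : E) (c : ℝ) (b : E) (T : E →L[ℝ] E) :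
    Continuous (quadraticAt x₀ c b T) := (contDiff_quadraticAt x₀ c b T).continuous

theorem hasFDerivAt_quadraticAt (x₀ : E) (c : ℝ) (b : E) {T : E →L[ℝ] E}
    (hT : (T : E →ₗ[ℝ] E).IsSymmetric) (x : E) :
    HasFDerivAt (quadraticAt x₀ c b T) (innerSL ℝ (b + T (x - x₀))) x := by
  have h1 : HasFDerivAt (fun x : E => x - x₀) (ContinuousLinearMap.id ℝ E) x :=
    (hasFDerivAt_id x).sub_const x₀
  have h2 : HasFDerivAt (fun x : E => T (x - x₀)) T x :=
    T.hasFDerivAt.comp x h1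
  have h3 := ((hasFDerivAt_const b x).inner ℝ h1).const_add c
  have h4 := h3.add ((h2.inner ℝ h1).const_mul (1 / 2))
  refine h4.congr_fderiv ?_
  ext d
  have h5 := hT d (x - x₀)
  simp only [ContinuousLinearMap.coe_coe] at h5
  simp only [fderivInnerCLM_apply, ContinuousLinearMap.comp_apply, ContinuousLinearMap.prod_apply,
    _root_.add_apply, _root_.smul_apply, innerSL_apply_apply, inner_add_left, smul_eq_mul,
    ContinuousLinearMap.id_apply, _root_.zero_apply, inner_zero_left, h5]
  rw [real_inner_comm (T (x - x₀)) d]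
  ring

end Jets

/-! ### Equivalence with viscosity solutions, and comparison -/

section Viscosity

variable {n : ℕ}

local notation "𝔼" => EuclideanSpace ℝ (Fin n)

theorem hessianMatrix_quadraticAt (x₀ : 𝔼) (c : ℝ) (b : 𝔼) {T : 𝔼 →L[ℝ] 𝔼}
    (hT : (T : 𝔼 →ₗ[ℝ] 𝔼).IsSymmetric) (x : 𝔼) :
    hessianMatrix (quadraticAt x₀ c b T) x = Matrix.of fun i j =>
      ⟪T (EuclideanSpace.single i 1), EuclideanSpace.single j 1⟫ := by
  have h1 : fderiv ℝ (quadraticAt x₀ c b T) = fun x => innerSL ℝ (b + T (x - x₀)) :=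
    funext fun x => (hasFDerivAt_quadraticAt x₀ c b hT x).fderiv
  have h2 : HasFDerivAt (fun x : 𝔼 => innerSL ℝ (b + T (x - x₀))) ((innerSL ℝ).comp T) x := by
    have h3 : HasFDerivAt (fun x : 𝔼 => b + T (x - x₀)) T x := by
      simpa using (T.hasFDerivAt.comp x ((hasFDerivAt_id x).sub_const x₀)).const_add b
    exact (innerSL ℝ).hasFDerivAt.comp x h3
  rw [hessianMatrix, h1, h2.fderiv]
  rfl

theorem lagrangianPhase_hessianMatrix_quadraticAt (x₀ : 𝔼) (c : ℝ) (b : 𝔼) {T : 𝔼 →L[ℝ] 𝔼}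
    (hT : (T : 𝔼 →ₗ[ℝ] 𝔼).IsSymmetric) (x : 𝔼) :
    lagrangianPhase (hessianMatrix (quadraticAt x₀ c b T) x) = operatorPhase T := by
  rw [hessianMatrix_quadraticAt x₀ c b hT, lagrangianPhase_of_inner hT]

/-- Second order Taylor expansion. -/
theorem ContDiffAt.exists_quadratic_expansion {f : 𝔼 → ℝ} {x₀ : 𝔼} (hf : ContDiffAt ℝ 2 f x₀) :
    ∃ (b : 𝔼) (T : 𝔼 →L[ℝ] 𝔼), (T : 𝔼 →ₗ[ℝ] 𝔼).IsSymmetric ∧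
      (hessianMatrix f x₀ = Matrix.of fun i j =>
        ⟪T (EuclideanSpace.single i 1), EuclideanSpace.single j 1⟫) ∧
      ∀ γ : ℝ, 0 < γ → ∀ᶠ x in 𝓝 x₀, |f x - quadraticAt x₀ (f x₀) b T x| ≤ γ * ‖x - x₀‖ ^ 2 := by
  set B := fderiv ℝ (fderiv ℝ f) x₀ with hB
  set b : 𝔼 := (InnerProductSpace.toDual ℝ 𝔼).symm (fderiv ℝ f x₀) with hb
  have hbi : ∀ v, ⟪b, v⟫ = fderiv ℝ f x₀ v := fun v => by
    rw [hb, InnerProductSpace.toDual_symm_apply]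
  set T : 𝔼 →L[ℝ] 𝔼 := ∑ i, (B.flip (EuclideanSpace.single i 1)).smulRight
    (EuclideanSpace.single i (1 : ℝ)) with hT
  have hTi : ∀ v w, ⟪T v, w⟫ = B v w := by
    intro v w
    have hw : w = ∑ i, w i • EuclideanSpace.single i (1 : ℝ) := by
      simpa using ((EuclideanSpace.basisFun (Fin n) ℝ).sum_repr w).symm
    conv_rhs => rw [hw, map_sum]
    rw [hT, _root_.sum_apply, sum_inner]
    refine Finset.sum_congr rfl fun i _ => ?_
    simp [real_inner_smul_left, EuclideanSpace.inner_single_left, mul_comm]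
  have hdf : ContDiffAt ℝ 1 (fderiv ℝ f) x₀ := hf.fderiv_right (by norm_num)
  have hBd : HasFDerivAt (fderiv ℝ f) B x₀ := (hdf.differentiableAt (by norm_num)).hasFDerivAt
  have hev : ∀ᶠ y in 𝓝 x₀, HasFDerivAt f (fderiv ℝ f y) y := by
    filter_upwards [hf.eventually (by simp)] with y hy
    exact (hy.differentiableAt (by norm_num)).hasFDerivAt
  have hsymm : ∀ v w, B v w = B w v := second_derivative_symmetric_of_eventually hev hBd
  have hTs : (T : 𝔼 →ₗ[ℝ] 𝔼).IsSymmetric := by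
    intro v w
    simp only [ContinuousLinearMap.coe_coe]
    rw [hTi, real_inner_comm, hTi, hsymm]
  refine ⟨b, T, hTs, ?_, fun γ hγ => ?_⟩
  · rw [hessianMatrix]
    ext i j
    simp only [Matrix.of_apply, hTi, hB]
  · have h1 := (hasFDerivAt_iff_isLittleO.1 hBd).def hγ
    obtain ⟨ρ, hρ, hball⟩ := Metric.eventually_nhds_iff_ball.1 (h1.and hev)
    filter_upwards [Metric.ball_mem_nhds x₀ hρ] with x hx
    have hseg : segment ℝ x₀ x ⊆ Metric.ball x₀ ρ :=
      (convex_ball x₀ ρ).segment_subset (Metric.mem_ball_self hρ) hx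
    have hder : ∀ y ∈ segment ℝ x₀ x,
        HasFDerivWithinAt (fun y => f y - quadraticAt x₀ (f x₀) b T y)
          (fderiv ℝ f y - innerSL ℝ (b + T (y - x₀))) (segment ℝ x₀ x) y := fun y hy =>
      ((hball y (hseg hy)).2.sub (hasFDerivAt_quadraticAt x₀ _ b hTs y)).hasFDerivWithinAt
    have hbound : ∀ y ∈ segment ℝ x₀ x,
        ‖fderiv ℝ f y - innerSL ℝ (b + T (y - x₀))‖ ≤ γ * ‖x - x₀‖ := by
      intro y hy
      have h2 : fderiv ℝ f y - innerSL ℝ (b + T (y - x₀))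
          = fderiv ℝ f y - fderiv ℝ f x₀ - B (y - x₀) := by
        ext v
        simp only [_root_.sub_apply, innerSL_apply_apply, inner_add_left, hbi, hTi]
        ring
      rw [h2]
      refine (hball y (hseg hy)).1.trans ?_
      gcongr
      exact norm_sub_le_of_mem_segment hy
    have h3 := (convex_segment x₀ x).norm_image_sub_le_of_norm_hasFDerivWithin_le hder hbound
      (left_mem_segment ℝ x₀ x) (right_mem_segment ℝ x₀ x)
    rw [quadraticAt_self, sub_self, sub_zero, Real.norm_eq_abs] at h3
    exact h3.trans (le_of_eq (by ring))

theorem le_operatorPhase_of_forall_pos {T : 𝔼 →L[ℝ] 𝔼} {ψ : ℝ}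
    (h : ∀ ε : ℝ, 0 < ε → ψ ≤ operatorPhase (T + ε • ContinuousLinearMap.id ℝ 𝔼)) :
    ψ ≤ operatorPhase T := by
  have h1 := (continuous_operatorPhase_add_smul_id T).tendsto 0
  simp only [zero_smul, add_zero] at h1
  exact ge_of_tendsto (h1.mono_left nhdsWithin_le_nhds)
    (eventually_nhdsWithin_of_forall (s := Ioi 0) fun ε hε => h ε hε)

theorem operatorPhase_le_of_forall_pos {T : 𝔼 →L[ℝ] 𝔼} {ψ : ℝ}
    (h : ∀ ε : ℝ, 0 < ε → operatorPhase (T + (-ε) • ContinuousLinearMap.id ℝ 𝔼) ≤ ψ) :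
    operatorPhase T ≤ ψ := by
  have h1 := ((continuous_operatorPhase_add_smul_id T).comp continuous_neg).tendsto 0
  simp only [Function.comp_apply, neg_zero, zero_smul, add_zero] at h1
  exact le_of_tendsto (h1.mono_left nhdsWithin_le_nhds)
    (eventually_nhdsWithin_of_forall (s := Ioi 0) fun ε hε => h ε hε)

/-- Quadratics are admissible test functions. Conversely, the Taylor remainder of a C² test function
is absorbed by adding ε to the Hessian, and ε tends to 0 by continuity of the phase along the
identity. -/
theorem isViscositySubsolution_iff {Ω : Set 𝔼} (hΩ : IsOpen Ω) {ψ : ℝ} {u : 𝔼 → ℝ} :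
    IsViscositySubsolution Ω ψ u ↔ UpperSemicontinuousOn u Ω ∧ IsJetSubsolution Ω ψ u := by
  constructor
  · refine fun h => ⟨h.usc, fun x hx b T hT hj => ?_⟩
    have h1 := h.test (quadraticAt x 0 b T) (contDiff_quadraticAt x 0 b T).contDiffOn x hx (by
      refine Filter.Eventually.filter_mono nhdsWithin_le_nhds ?_
      filter_upwards [hj] with y hy
      rw [quadraticAt_self, quadraticAt]
      linarith)
    rwa [lagrangianPhase_hessianMatrix_quadraticAt x 0 b hT] at h1
  · rintro ⟨husc, h⟩
    refine ⟨husc, fun f hf x hx hmax => ?_⟩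
    obtain ⟨b, T, hT, hH, hexp⟩ := (hf.contDiffAt (hΩ.mem_nhds hx)).exists_quadratic_expansion
    rw [hH, lagrangianPhase_of_inner hT]
    refine le_operatorPhase_of_forall_pos fun ε hε => ?_
    refine h x hx b _ (isSymmetric_add_smul_id hT ε) ?_
    have hmax' : IsLocalMax (fun y => u y - f y) x := hmax.isLocalMax (hΩ.mem_nhds hx)
    filter_upwards [hmax', hexp (ε / 2) (half_pos hε)] with y hy hy'
    have := (abs_le.1 hy').2
    rw [quadraticAt] at this
    rw [inner_add_smul_id]
    linarith

theorem isViscositySupersolution_iff {Ω : Set 𝔼} (hΩ : IsOpen Ω) {ψ : ℝ} {v : 𝔼 → ℝ} :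
    IsViscositySupersolution Ω ψ v ↔ LowerSemicontinuousOn v Ω ∧ IsJetSupersolution Ω ψ v := by
  constructor
  · refine fun h => ⟨h.lsc, fun x hx b T hT hj => ?_⟩
    have h1 := h.test (quadraticAt x 0 (-b) (-T)) (contDiff_quadraticAt x 0 (-b) (-T)).contDiffOn
      x hx (by
      refine Filter.Eventually.filter_mono nhdsWithin_le_nhds ?_
      filter_upwards [hj] with y hy
      rw [quadraticAt_self, quadraticAt, _root_.neg_apply, inner_neg_left, inner_neg_left]
      linarith)
    rwa [lagrangianPhase_hessianMatrix_quadraticAt x 0 (-b) (isSymmetric_neg hT)] at h1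
  · rintro ⟨hlsc, h⟩
    refine ⟨hlsc, fun f hf x hx hmin => ?_⟩
    obtain ⟨b, T, hT, hH, hexp⟩ := (hf.contDiffAt (hΩ.mem_nhds hx)).exists_quadratic_expansion
    rw [hH, lagrangianPhase_of_inner hT]
    refine operatorPhase_le_of_forall_pos fun ε hε => ?_
    have hT' := isSymmetric_add_smul_id (isSymmetric_neg hT) ε
    have hneg : T + (-ε) • ContinuousLinearMap.id ℝ 𝔼
        = -(-T + ε • ContinuousLinearMap.id ℝ 𝔼) := by
      module
    rw [hneg]
    refine h x hx (-b) _ hT' ?_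
    have hmin' : IsLocalMin (fun y => v y - f y) x := hmin.isLocalMin (hΩ.mem_nhds hx)
    filter_upwards [hmin', hexp (ε / 2) (half_pos hε)] with y hy hy'
    have := (abs_le.1 hy').1
    rw [quadraticAt] at this
    rw [inner_add_smul_id, _root_.neg_apply, inner_neg_left, inner_neg_left]
    linarith

/-- Comparison principle. -/
theorem IsJetSubsolution.le_of_le_frontier [NeZero n] {Ω : Set 𝔼} (hΩ : IsOpen Ω)
    (hb : Bornology.IsBounded Ω) {ψ : ℝ} {u v : 𝔼 → ℝ} (hu : UpperSemicontinuousOn u (closure Ω))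
    (hv : LowerSemicontinuousOn v (closure Ω)) (hsub : IsJetSubsolution Ω ψ u)
    (hsup : IsJetSupersolution Ω ψ v) (hbd : ∀ x ∈ frontier Ω, u x ≤ v x) :
    ∀ x ∈ closure Ω, u x ≤ v x := by
  intro z₀ hz₀
  by_contra hlt
  push Not at hlt
  have hK : IsCompact (closure Ω) := hb.isCompact_closure
  obtain ⟨R, hR, hRK⟩ := hK.isBounded.exists_pos_norm_le
  set θ := u z₀ - v z₀ with hθ
  have hθ0 : 0 < θ := sub_pos.2 hlt
  -- The perturbation is then at most θ/4 on the closure, below the level θ/2 used on the boundary.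
  set δ := θ / (2 * R ^ 2) with hδ
  have hδ0 : 0 < δ := by positivity
  have hδR : δ / 2 * R ^ 2 = θ / 4 := by rw [hδ]; field_simp; norm_num
  have hU : UpperSemicontinuousOn (fun x => u x + δ / 2 * ‖x‖ ^ 2) (closure Ω) := by
    have hc : Continuous fun x : 𝔼 => δ / 2 * ‖x‖ ^ 2 := by fun_prop
    exact hu.add (hc.upperSemicontinuous.upperSemicontinuousOn _)
  have hV : UpperSemicontinuousOn (fun x => -v x) (closure Ω) := by
    intro x hx c hc
    filter_upwards [hv x hx (-c) (by linarith)] with y hy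
    linarith
  obtain ⟨x, hx, y, hy, b, c, A, B, hA, hB, hJA, hJB, hAB⟩ :=
    exists_isSuperjet_add_nonpos hK hΩ subset_closure hU hV hz₀ (θ := θ / 2) (by
      intro x hx
      rw [← hΩ.frontier_eq] at hx
      have h1 := hbd x hx
      have h2 : ‖x‖ ^ 2 ≤ R ^ 2 := by
        have := hRK x (frontier_subset_closure hx)
        gcongr
      have h3 : δ / 2 * ‖x‖ ^ 2 ≤ δ / 2 * R ^ 2 := by gcongr
      linarith) (by
      have : 0 ≤ δ / 2 * ‖z₀‖ ^ 2 := by positivity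
      linarith)
  -- Removing the perturbation lowers the Hessian by δ. A and B stay fixed while ε tends to 0, so
  -- strict monotonicity suffices without uniform ellipticity.
  have h1 : ψ ≤ operatorPhase (A + (-δ) • ContinuousLinearMap.id ℝ 𝔼) := by
    refine le_operatorPhase_of_forall_pos fun ε hε => ?_
    refine hsub x hx (b - δ • x) _
      (isSymmetric_add_smul_id (isSymmetric_add_smul_id hA (-δ)) ε) ?_
    filter_upwards [hJA ε hε] with z hz
    have h2 : ‖z‖ ^ 2 = ‖x‖ ^ 2 + 2 * ⟪x, z - x⟫ + ‖z - x‖ ^ 2 := by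
      rw [← norm_add_sq_real, add_sub_cancel]
    rw [h2, inner_add_smul_id] at hz
    rw [inner_add_smul_id, inner_add_smul_id, inner_sub_left, real_inner_smul_left]
    linarith
  have h2 : operatorPhase (-B) ≤ ψ := by
    refine operatorPhase_le_of_forall_pos fun ε hε => ?_
    have hneg : -B + (-ε) • ContinuousLinearMap.id ℝ 𝔼
        = -(B + ε • ContinuousLinearMap.id ℝ 𝔼) := by
      module
    rw [hneg]
    exact hsup y hy c _ (isSymmetric_add_smul_id hB ε) (hJB ε hε)
  have h3 := operatorPhase_lt_add_smul_id (isSymmetric_add_smul_id hA (-δ)) hδ0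
  have h4 : A + (-δ) • ContinuousLinearMap.id ℝ 𝔼 + δ • ContinuousLinearMap.id ℝ 𝔼 = A := by
    module
  rw [h4] at h3
  have h5 := operatorPhase_mono hA (isSymmetric_neg hB) fun d => by
    rw [_root_.neg_apply, inner_neg_left]
    linarith [hAB d]
  linarith

end Viscosity

/-! ### Quadratic sub- and supersolutions -/

section Quadratic

variable {E : Type*} [NormedAddCommGroup E] [InnerProductSpace ℝ E]

theorem quadraticAt_recenter (x₀ : E) (c : ℝ) (b : E) {T : E →L[ℝ] E}
    (hT : (T : E →ₗ[ℝ] E).IsSymmetric) (x y : E) :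
    quadraticAt x₀ c b T y =
      quadraticAt x₀ c b T x + ⟪b + T (x - x₀), y - x⟫ + 1 / 2 * ⟪T (y - x), y - x⟫ := by
  have h1 : y - x₀ = (x - x₀) + (y - x) := by abel
  have h2 := hT (y - x) (x - x₀)
  simp only [ContinuousLinearMap.coe_coe] at h2
  simp only [quadraticAt]
  rw [h1, map_add]
  simp only [inner_add_left, inner_add_right]
  rw [h2, real_inner_comm (T (x - x₀)) (y - x)]
  ring

theorem IsSuperjet.congr {u v : E → ℝ} {x b : E} {T : E →L[ℝ] E} (h : IsSuperjet u x b T)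
    (huv : u =ᶠ[𝓝 x] v) : IsSuperjet v x b T := by
  filter_upwards [h, huv] with y hy hy'
  rwa [← hy', ← huv.self_of_nhds]

/-- A smaller function with the same value at the base point has the same superjets. -/
theorem IsSuperjet.of_le {u v : E → ℝ} {x b : E} {T : E →L[ℝ] E} (h : IsSuperjet u x b T)
    (hle : ∀ᶠ y in 𝓝 x, v y ≤ u y) (heq : v x = u x) : IsSuperjet v x b T := by
  filter_upwards [h, hle] with y hy hy'
  rw [heq]
  exact hy'.trans hy

/-- Adding the inequalities at x + td and x - td cancels the gradients. -/
theorem IsSuperjet.inner_le {x₀ b x b' : E} {c : ℝ} {S T : E →L[ℝ] E}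
    (hS : (S : E →ₗ[ℝ] E).IsSymmetric) (h : IsSuperjet (quadraticAt x₀ c b S) x b' T) (d : E) :
    ⟪S d, d⟫ ≤ ⟪T d, d⟫ := by
  have hpos : Filter.Tendsto (fun t : ℝ => x + t • d) (𝓝[>] 0) (𝓝 x) := by
    have : Continuous fun t : ℝ => x + t • d := by fun_prop
    simpa using (this.tendsto 0).mono_left nhdsWithin_le_nhds
  have hneg : Filter.Tendsto (fun t : ℝ => x + (-t) • d) (𝓝[>] 0) (𝓝 x) := by
    have : Continuous fun t : ℝ => x + (-t) • d := by fun_prop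
    simpa using (this.tendsto 0).mono_left nhdsWithin_le_nhds
  obtain ⟨t, ⟨h1, h2⟩, ht⟩ :=
    ((hpos.eventually h).and (hneg.eventually h)).and self_mem_nhdsWithin |>.exists
  have ht : 0 < t := ht
  rw [quadraticAt_recenter x₀ c b hS x, add_sub_cancel_left] at h1 h2
  simp only [map_smul, real_inner_smul_left, real_inner_smul_right] at h1 h2
  have h3 : t ^ 2 * ⟪S d, d⟫ ≤ t ^ 2 * ⟪T d, d⟫ := by linarith
  exact le_of_mul_le_mul_left h3 (by positivity)

theorem isSymmetric_smul_id (c : ℝ) :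
    ((c • ContinuousLinearMap.id ℝ E : E →L[ℝ] E) : E →ₗ[ℝ] E).IsSymmetric := by
  intro x y
  simp [real_inner_smul_left, real_inner_smul_right]

variable [FiniteDimensional ℝ E]

theorem isJetSubsolution_quadraticAt (Ω : Set E) {ψ : ℝ} (x₀ : E) (c : ℝ) (b : E) {S : E →L[ℝ] E}
    (hS : (S : E →ₗ[ℝ] E).IsSymmetric) (hψ : ψ ≤ operatorPhase S) :
    IsJetSubsolution Ω ψ (quadraticAt x₀ c b S) := fun _ _ _ _ hT h =>
  hψ.trans (operatorPhase_mono hS hT fun d => h.inner_le hS d)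

theorem isJetSupersolution_quadraticAt (Ω : Set E) {ψ : ℝ} (x₀ : E) (c : ℝ) (b : E)
    {S : E →L[ℝ] E} (hS : (S : E →ₗ[ℝ] E).IsSymmetric)
    (hψ : operatorPhase S ≤ ψ) : IsJetSupersolution Ω ψ (quadraticAt x₀ c b S) := by
  intro x _ b' T hT h
  have hneg : (fun y => -quadraticAt x₀ c b S y) = quadraticAt x₀ (-c) (-b) (-S) := by
    ext y
    simp only [quadraticAt, inner_neg_left, _root_.neg_apply]
    ring
  rw [hneg] at h
  refine (operatorPhase_mono (isSymmetric_neg hT) hS fun d => ?_).trans hψ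
  have := h.inner_le (isSymmetric_neg hS) d
  rw [_root_.neg_apply, inner_neg_left] at this ⊢
  linarith

end Quadratic

/-! ### Perron's method -/

section Perron

variable {n : ℕ}

local notation "𝔼" => EuclideanSpace ℝ (Fin n)

/-- The function equal to `f` in the ball of radius `ρ` and to `g` outside. -/
def ballGlue {X : Type*} [MetricSpace X] (x₀ : X) (ρ : ℝ) (f g : X → ℝ) (x : X) : ℝ :=
  open scoped Classical in if dist x x₀ < ρ then f x else g x

/-- Agreement on the annulus leaves no seam on the sphere, so local properties of f and g pass to
the glued function. -/
theorem ballGlue_eventuallyEq {X : Type*} [MetricSpace X] {K : Set X} {x₀ : X} {ρ : ℝ} (hρ : 0 < ρ)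
    {f g : X → ℝ} (hfg : ∀ x ∈ K, ρ / 2 < dist x x₀ → dist x x₀ < ρ → f x = g x) (x : X) :
    ballGlue x₀ ρ f g =ᶠ[𝓝[K] x] f ∨ ballGlue x₀ ρ f g =ᶠ[𝓝[K] x] g := by
  have hc : Continuous fun y => dist y x₀ := by fun_prop
  rcases lt_or_ge (dist x x₀) ρ with hx | hx
  · left
    filter_upwards [nhdsWithin_le_nhds (hc.continuousAt.eventually (gt_mem_nhds hx))] with y hy
    simp [ballGlue, hy]
  · right
    have hx' : ρ / 2 < dist x x₀ := by linarith
    filter_upwards [nhdsWithin_le_nhds (hc.continuousAt.eventually (lt_mem_nhds hx')),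
      self_mem_nhdsWithin] with y hy hyK
    by_cases hy' : dist y x₀ < ρ
    · simp [ballGlue, hy', hfg y hyK hy hy']
    · simp [ballGlue, hy']

theorem upperSemicontinuousOn_ballGlue {X : Type*} [MetricSpace X] {K : Set X} {x₀ : X} {ρ : ℝ}
    (hρ : 0 < ρ) {f g : X → ℝ}
    (hfg : ∀ x ∈ K, ρ / 2 < dist x x₀ → dist x x₀ < ρ → f x = g x)
    (hf : UpperSemicontinuousOn f K) (hg : UpperSemicontinuousOn g K) :
    UpperSemicontinuousOn (ballGlue x₀ ρ f g) K := by
  intro x hx c hc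
  rcases ballGlue_eventuallyEq hρ hfg x with h | h
  · rw [h.self_of_nhdsWithin hx] at hc
    filter_upwards [h, hf x hx c hc] with y hy hy'
    rwa [hy]
  · rw [h.self_of_nhdsWithin hx] at hc
    filter_upwards [h, hg x hx c hc] with y hy hy'
    rwa [hy]

theorem lowerSemicontinuousOn_ballGlue {X : Type*} [MetricSpace X] {K : Set X} {x₀ : X} {ρ : ℝ}
    (hρ : 0 < ρ) {f g : X → ℝ}
    (hfg : ∀ x ∈ K, ρ / 2 < dist x x₀ → dist x x₀ < ρ → f x = g x)
    (hf : LowerSemicontinuousOn f K) (hg : LowerSemicontinuousOn g K) :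
    LowerSemicontinuousOn (ballGlue x₀ ρ f g) K := by
  intro x hx c hc
  rcases ballGlue_eventuallyEq hρ hfg x with h | h
  · rw [h.self_of_nhdsWithin hx] at hc
    filter_upwards [h, hf x hx c hc] with y hy hy'
    rwa [hy]
  · rw [h.self_of_nhdsWithin hx] at hc
    filter_upwards [h, hg x hx c hc] with y hy hy'
    rwa [hy]

/-- The least upper semicontinuous majorant. -/
theorem exists_usc_hull {X : Type*} [TopologicalSpace X] {K : Set X} {U g₀ : X → ℝ}
    (hg₀ : UpperSemicontinuousOn g₀ K) (hU : ∀ x ∈ K, U x ≤ g₀ x) :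
    ∃ V : X → ℝ, UpperSemicontinuousOn V K ∧ (∀ x ∈ K, U x ≤ V x) ∧
      ∀ g : X → ℝ, UpperSemicontinuousOn g K → (∀ x ∈ K, U x ≤ g x) → ∀ x ∈ K, V x ≤ g x := by
  set S : Set (X → ℝ) := {g | UpperSemicontinuousOn g K ∧ ∀ x ∈ K, U x ≤ g x} with hS
  have hbdd : ∀ x ∈ K, BddBelow ((fun g : X → ℝ => g x) '' S) := by
    rintro x hx
    refine ⟨U x, ?_⟩
    rintro _ ⟨g, hg, rfl⟩
    exact hg.2 x hx
  have hne : ∀ x, ((fun g : X → ℝ => g x) '' S).Nonempty := fun x => ⟨g₀ x, g₀, ⟨hg₀, hU⟩, rfl⟩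
  refine ⟨fun x => sInf ((fun g : X → ℝ => g x) '' S), fun x hx c hc => ?_, fun x hx => ?_,
    fun g hg hUg x hx => csInf_le (hbdd x hx) ⟨g, ⟨hg, hUg⟩, rfl⟩⟩
  · obtain ⟨_, ⟨g, hg, rfl⟩, hgc⟩ := exists_lt_of_csInf_lt (hne x) hc
    filter_upwards [hg.1 x hx c hgc, self_mem_nhdsWithin] with y hy hyK
    exact (csInf_le (hbdd y hyK) ⟨g, hg, rfl⟩).trans_lt hy
  · refine le_csInf (hne x) ?_
    rintro _ ⟨g, hg, rfl⟩
    exact hg.2 x hx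

/-- The greatest lower semicontinuous minorant. -/
theorem exists_lsc_hull {X : Type*} [TopologicalSpace X] {K : Set X} {U g₀ : X → ℝ}
    (hg₀ : LowerSemicontinuousOn g₀ K) (hU : ∀ x ∈ K, g₀ x ≤ U x) :
    ∃ V : X → ℝ, LowerSemicontinuousOn V K ∧ (∀ x ∈ K, V x ≤ U x) ∧
      ∀ g : X → ℝ, LowerSemicontinuousOn g K → (∀ x ∈ K, g x ≤ U x) → ∀ x ∈ K, g x ≤ V x := by
  have hneg : ∀ {g : X → ℝ}, LowerSemicontinuousOn g K → UpperSemicontinuousOn (fun x => -g x) K :=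
    fun hg x hx c hc => by
      filter_upwards [hg x hx (-c) (by linarith)] with y hy
      linarith
  obtain ⟨V, hV, hUV, hmax⟩ := exists_usc_hull (U := fun x => -U x) (hneg hg₀)
    fun x hx => neg_le_neg (hU x hx)
  refine ⟨fun x => -V x, fun x hx c hc => ?_, fun x hx => by linarith [hUV x hx],
    fun g hg hgU x hx => ?_⟩
  · filter_upwards [hV x hx (-c) (by linarith)] with y hy
    linarith
  · linarith [hmax _ (hneg hg) (fun y hy => neg_le_neg (hgU y hy)) x hx]

/-- The subsolutions competing in Perron's method. -/
structure IsPerronCompetitor (Ω : Set 𝔼) (ψ : ℝ) (φ w : 𝔼 → ℝ) : Prop where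
  usc : UpperSemicontinuousOn w (closure Ω)
  sub : IsJetSubsolution Ω ψ w
  boundary : ∀ x ∈ frontier Ω, w x ≤ φ x

theorem exists_closedBall_of_eventually {X : Type*} [MetricSpace X] {Ω : Set X} (hΩ : IsOpen Ω)
    {x : X} (hx : x ∈ Ω) {P : X → Prop} (hP : ∀ᶠ y in 𝓝 x, P y) :
    ∃ ρ > 0, ∀ y, dist y x ≤ ρ → y ∈ Ω ∧ P y := by
  obtain ⟨ρ, hρ, h⟩ := Metric.nhds_basis_closedBall.eventually_iff.1
    ((hΩ.eventually_mem hx).and hP)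
  exact ⟨ρ, hρ, fun y hy => h hy⟩

/-- A subsolution touched strictly from above on a sphere by a strict quadratic supersolution stays
below it in the ball. -/
theorem IsJetSubsolution.le_sub_of_le_sphere {Ω : Set 𝔼} {ψ : ℝ} {w : 𝔼 → ℝ}
    (hw : IsJetSubsolution Ω ψ w) {x₀ : 𝔼} {ρ : ℝ} (hρ : 0 < ρ)
    (hball : Metric.closedBall x₀ ρ ⊆ Ω)
    (husc : UpperSemicontinuousOn w (Metric.closedBall x₀ ρ)) {c s : ℝ} {b : 𝔼} {T : 𝔼 →L[ℝ] 𝔼}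
    (hT : (T : 𝔼 →ₗ[ℝ] 𝔼).IsSymmetric) (hψ : operatorPhase T < ψ)
    (hs : ∀ y, dist y x₀ = ρ → w y ≤ quadraticAt x₀ c b T y - s) :
    ∀ y ∈ Metric.closedBall x₀ ρ, w y ≤ quadraticAt x₀ c b T y - s := by
  set q := quadraticAt x₀ c b T with hq
  have hc : Continuous fun y => -q y := (continuous_quadraticAt x₀ c b T).neg
  obtain ⟨x₁, hx₁, hmax⟩ :=
    (husc.add (hc.upperSemicontinuous.upperSemicontinuousOn _)).exists_isMaxOn
    ⟨x₀, Metric.mem_closedBall_self hρ.le⟩ (isCompact_closedBall x₀ ρ)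
  have hmax' : ∀ y ∈ Metric.closedBall x₀ ρ, w y + -q y ≤ w x₁ + -q x₁ := fun y hy => hmax hy
  rcases (Metric.mem_closedBall.1 hx₁).lt_or_eq with hlt | heq
  · exfalso
    -- At an interior maximum of w - q, the quadratic recentred at `x₁` touches w from above with
    -- the same Hessian T, whose phase is too small.
    refine absurd (hw x₁ (hball hx₁) (b + T (x₁ - x₀)) T hT ?_) (not_le.2 hψ)
    filter_upwards [Metric.isOpen_ball.mem_nhds (Metric.mem_ball.2 hlt)] with y hy
    have h1 := hmax' y (Metric.ball_subset_closedBall hy)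
    have h2 := quadraticAt_recenter x₀ c b hT x₁ y
    rw [← hq] at h2
    linarith
  · intro y hy
    linarith [hmax' y hy, hs x₁ heq]

/-- There is a greatest Perron competitor. -/
theorem exists_greatest_isPerronCompetitor [NeZero n] {Ω : Set 𝔼} (hΩ : IsOpen Ω)
    (hb : Bornology.IsBounded Ω) {ψ : ℝ} {φ w₀ W₀ : 𝔼 → ℝ} (hw₀ : IsPerronCompetitor Ω ψ φ w₀)
    (hW₀ : Continuous W₀) (hW₀s : IsJetSupersolution Ω ψ W₀) (hW₀b : ∀ x ∈ frontier Ω, φ x ≤ W₀ x)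
    (hupp : ∀ x₀ ∈ frontier Ω, ∀ ε : ℝ, 0 < ε → ∃ W : 𝔼 → ℝ, Continuous W ∧
      IsJetSupersolution Ω ψ W ∧ (∀ x ∈ frontier Ω, φ x ≤ W x) ∧ W x₀ ≤ φ x₀ + ε) :
    ∃ V, IsPerronCompetitor Ω ψ φ V ∧
      ∀ w, IsPerronCompetitor Ω ψ φ w → ∀ x ∈ closure Ω, w x ≤ V x := by
  have hcomp : ∀ w, IsPerronCompetitor Ω ψ φ w → ∀ W : 𝔼 → ℝ, Continuous W →
      IsJetSupersolution Ω ψ W → (∀ x ∈ frontier Ω, φ x ≤ W x) → ∀ x ∈ closure Ω, w x ≤ W x :=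
    fun w hw W hW hWs hWb => hw.sub.le_of_le_frontier hΩ hb hw.usc
      (hW.lowerSemicontinuous.lowerSemicontinuousOn _) hWs
      fun x hx => (hw.boundary x hx).trans (hWb x hx)
  set S : Set (𝔼 → ℝ) := {w | IsPerronCompetitor Ω ψ φ w}
  set U : 𝔼 → ℝ := fun x => sSup ((fun w : 𝔼 → ℝ => w x) '' S) with hU
  have hne : ∀ x, ((fun w : 𝔼 → ℝ => w x) '' S).Nonempty := fun x => ⟨_, w₀, hw₀, rfl⟩
  have hUle : ∀ x, ∀ c, (∀ w ∈ S, w x ≤ c) → U x ≤ c := by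
    intro x c h
    refine csSup_le (hne x) ?_
    rintro _ ⟨w, hw, rfl⟩
    exact h w hw
  have hleU : ∀ w ∈ S, ∀ x ∈ closure Ω, w x ≤ U x := by
    intro w hw x hx
    refine le_csSup ⟨W₀ x, ?_⟩ ⟨w, hw, rfl⟩
    rintro _ ⟨w', hw', rfl⟩
    exact hcomp w' hw' W₀ hW₀ hW₀s hW₀b x hx
  obtain ⟨V, hV, hUV, hmin⟩ := exists_usc_hull (K := closure Ω) (U := U)
    (hW₀.upperSemicontinuous.upperSemicontinuousOn _)
    fun x hx => hUle x _ fun w hw => hcomp w hw W₀ hW₀ hW₀s hW₀b x hx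
  refine ⟨V, ⟨hV, ?_, ?_⟩, fun w hw x hx => (hleU w hw x hx).trans (hUV x hx)⟩
  · intro x₀ hx₀ b T hT hj
    refine le_operatorPhase_of_forall_pos fun ε hε => ?_
    by_contra hlt
    push Not at hlt
    have hT' := isSymmetric_add_smul_id hT ε
    set q := quadraticAt x₀ (V x₀) b (T + ε • ContinuousLinearMap.id ℝ 𝔼) with hq
    have hev : ∀ᶠ y in 𝓝 x₀, V y ≤ q y - ε / 2 * dist y x₀ ^ 2 := by
      filter_upwards [hj] with y hy
      rw [hq, quadraticAt, inner_add_smul_id, dist_eq_norm]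
      linarith
    obtain ⟨ρ, hρ, hball⟩ := exists_closedBall_of_eventually hΩ hx₀ hev
    set s := ε / 2 * (ρ / 2) ^ 2 with hs
    have hs0 : 0 < s := by positivity
    have hVs : ∀ y, ρ / 2 < dist y x₀ → dist y x₀ ≤ ρ → V y ≤ q y - s := by
      intro y hy1 hy2
      refine (hball y hy2).2.trans ?_
      have : ε / 2 * (ρ / 2) ^ 2 ≤ ε / 2 * dist y x₀ ^ 2 := by gcongr
      linarith
    have hsub : Metric.closedBall x₀ ρ ⊆ Ω := fun y hy => (hball y hy).1
    -- Each competitor lies below q - s on the sphere, hence in the ball. So V can be cut down to q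
    -- - s near x₀ and still majorize U, contradicting minimality of the hull.
    have hUs : ∀ y, dist y x₀ ≤ ρ → U y ≤ q y - s := by
      intro y hy
      refine hUle y _ fun w hw => ?_
      refine IsJetSubsolution.le_sub_of_le_sphere hw.sub hρ hsub
        (hw.usc.mono (hsub.trans subset_closure)) hT' hlt (fun z hz => ?_) y hy
      have hzK := subset_closure (hball z hz.le).1
      exact ((hleU w hw z hzK).trans (hUV z hzK)).trans (hVs z (by linarith) hz.le)
    have hcq : Continuous fun y => q y - s :=
      (continuous_quadraticAt _ _ _ _).sub continuous_const
    have hagree : ∀ x ∈ closure Ω, ρ / 2 < dist x x₀ → dist x x₀ < ρ →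
        min (V x) (q x - s) = V x := fun x _ h1 h2 => min_eq_left (hVs x h1 h2.le)
    have hg : UpperSemicontinuousOn (ballGlue x₀ ρ (fun x => min (V x) (q x - s)) V) (closure Ω) :=
      upperSemicontinuousOn_ballGlue hρ hagree
        (hV.inf (hcq.upperSemicontinuous.upperSemicontinuousOn _)) hV
    have h1 := hmin _ hg (fun x hx => by
      by_cases hxρ : dist x x₀ < ρ
      · simp only [ballGlue, hxρ, if_true]
        exact le_min (hUV x hx) (hUs x hxρ.le)
      · simp only [ballGlue, hxρ, if_false]
        exact hUV x hx) x₀ (subset_closure hx₀)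
    simp only [ballGlue, dist_self, hρ, if_true] at h1
    have h2 := h1.trans (min_le_right _ _)
    rw [hq, quadraticAt_self] at h2
    linarith
  · intro x hx
    refine le_of_forall_pos_le_add fun ε hε => ?_
    obtain ⟨W, hW, hWs, hWb, hWx⟩ := hupp x hx ε hε
    refine (hmin W (hW.upperSemicontinuous.upperSemicontinuousOn _) (fun y hy => ?_) x
      (frontier_subset_closure hx)).trans hWx
    exact hUle y _ fun w hw => hcomp w hw W hW hWs hWb y hy

/-- The bump construction: raising a competitor by a strict quadratic subsolution. -/
theorem IsPerronCompetitor.ballGlue_sup {Ω : Set 𝔼} (hΩ : IsOpen Ω) {ψ : ℝ} {φ U : 𝔼 → ℝ}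
    (hU : IsPerronCompetitor Ω ψ φ U) {x₀ : 𝔼} {ρ : ℝ} (hρ : 0 < ρ)
    (hball : Metric.closedBall x₀ ρ ⊆ Ω) {q : 𝔼 → ℝ} (hq : Continuous q)
    (hqs : IsJetSubsolution Ω ψ q)
    (hle : ∀ x, ρ / 2 < dist x x₀ → dist x x₀ < ρ → q x ≤ U x) :
    IsPerronCompetitor Ω ψ φ (ballGlue x₀ ρ (fun x => max (U x) (q x)) U) := by
  have hagree : ∀ x ∈ closure Ω, ρ / 2 < dist x x₀ → dist x x₀ < ρ →
      max (U x) (q x) = U x := fun x _ h1 h2 => max_eq_left (hle x h1 h2)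
  refine ⟨upperSemicontinuousOn_ballGlue hρ hagree
    (hU.usc.sup (hq.upperSemicontinuous.upperSemicontinuousOn _)) hU.usc, ?_, ?_⟩
  · intro x hx b T hT hj
    have hnhds : 𝓝[closure Ω] x = 𝓝 x :=
      nhdsWithin_eq_nhds.2 (Filter.mem_of_superset (hΩ.mem_nhds hx) subset_closure)
    rcases ballGlue_eventuallyEq hρ hagree x with h | h
    · rw [hnhds] at h
      have hj' := hj.congr h
      rcases le_total (q x) (U x) with hx' | hx'
      · exact hU.sub x hx b T hT (hj'.of_le (Filter.Eventually.of_forall fun y => le_max_left _ _)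
          (max_eq_left hx').symm)
      · exact hqs x hx b T hT (hj'.of_le (Filter.Eventually.of_forall fun y => le_max_right _ _)
          (max_eq_right hx').symm)
    · rw [hnhds] at h
      exact hU.sub x hx b T hT (hj.congr h)
  · intro x hx
    have hxρ : ¬ dist x x₀ < ρ := fun h => by
      rw [hΩ.frontier_eq] at hx
      exact hx.2 (hball (Metric.mem_closedBall.2 h.le))
    simp only [ballGlue, hxρ, if_false]
    exact hU.boundary x hx

/-- The lower semicontinuous hull of the greatest competitor is a supersolution. -/
theorem exists_isJetSupersolution_le {Ω : Set 𝔼} (hΩ : IsOpen Ω) {ψ : ℝ} {φ U g₀ : 𝔼 → ℝ}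
    (hU : IsPerronCompetitor Ω ψ φ U)
    (hmax : ∀ w, IsPerronCompetitor Ω ψ φ w → ∀ x ∈ closure Ω, w x ≤ U x)
    (hg₀ : Continuous g₀) (hg₀s : IsPerronCompetitor Ω ψ φ g₀)
    (hlow : ∀ x₀ ∈ frontier Ω, ∀ ε : ℝ, 0 < ε → ∃ w : 𝔼 → ℝ, Continuous w ∧
      IsPerronCompetitor Ω ψ φ w ∧ φ x₀ - ε ≤ w x₀) :
    ∃ W, LowerSemicontinuousOn W (closure Ω) ∧ IsJetSupersolution Ω ψ W ∧
      (∀ x ∈ closure Ω, W x ≤ U x) ∧ ∀ x ∈ frontier Ω, φ x ≤ W x := by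
  obtain ⟨W, hW, hWU, hWmax⟩ := exists_lsc_hull (K := closure Ω) (U := U)
    (hg₀.lowerSemicontinuous.lowerSemicontinuousOn _) (hmax g₀ hg₀s)
  refine ⟨W, hW, ?_, hWU, ?_⟩
  · intro x₀ hx₀ b T hT hj
    refine operatorPhase_le_of_forall_pos fun ε hε => ?_
    by_contra hlt
    push Not at hlt
    have hT' := isSymmetric_add_smul_id (isSymmetric_neg hT) (-ε)
    set s' : ℝ → 𝔼 → ℝ := fun c =>
      quadraticAt x₀ c (-b) (-T + (-ε) • ContinuousLinearMap.id ℝ 𝔼) with hs'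
    have hev : ∀ᶠ y in 𝓝 x₀, s' (W x₀) y + ε / 2 * dist y x₀ ^ 2 ≤ W y := by
      filter_upwards [hj] with y hy
      simp only [hs', quadraticAt, inner_add_smul_id, dist_eq_norm, _root_.neg_apply,
        inner_neg_left]
      linarith
    obtain ⟨ρ, hρ, hball⟩ := exists_closedBall_of_eventually hΩ hx₀ hev
    set s := ε / 2 * (ρ / 2) ^ 2 with hs
    have hs0 : 0 < s := by positivity
    set q := s' (W x₀ + s) with hq
    have hqs : ∀ y, q y = s' (W x₀) y + s := by
      intro y
      simp only [hq, hs', quadraticAt]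
      ring
    have hqc : Continuous q := continuous_quadraticAt _ _ _ _
    have hqW : ∀ y, ρ / 2 < dist y x₀ → dist y x₀ < ρ → q y ≤ W y := by
      intro y h1 h2
      have h3 := (hball y h2.le).2
      have : ε / 2 * (ρ / 2) ^ 2 ≤ ε / 2 * dist y x₀ ^ 2 := by gcongr
      rw [hqs]
      linarith
    have hsub : Metric.closedBall x₀ ρ ⊆ Ω := fun y hy => (hball y hy).1
    have hWU' : ∀ y, dist y x₀ < ρ → W y ≤ U y := fun y hy =>
      hWU y (subset_closure (hball y hy.le).1)
    -- Maximality of U against this bump yields q ≤ U in the ball. Then max(W, q) is a lower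
    -- semicontinuous minorant of U exceeding W by s at x₀.
    have hbump := hU.ballGlue_sup hΩ hρ hsub hqc
      (isJetSubsolution_quadraticAt Ω x₀ _ _ hT' hlt.le)
      fun y h1 h2 => (hqW y h1 h2).trans (hWU' y h2)
    have hqU : ∀ y, dist y x₀ < ρ → q y ≤ U y := by
      intro y hy
      have h1 := hmax _ hbump y (subset_closure (hball y hy.le).1)
      simp only [ballGlue, hy, if_true] at h1
      exact (le_max_right _ _).trans h1
    have hg : LowerSemicontinuousOn (ballGlue x₀ ρ (fun x => max (W x) (q x)) W) (closure Ω) :=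
      lowerSemicontinuousOn_ballGlue hρ (fun x _ h1 h2 => max_eq_left (hqW x h1 h2))
        (hW.sup (hqc.lowerSemicontinuous.lowerSemicontinuousOn _)) hW
    have h1 := hWmax _ hg (fun x hx => by
      by_cases hxρ : dist x x₀ < ρ
      · simp only [ballGlue, hxρ, if_true]
        exact max_le (hWU x hx) (hqU x hxρ)
      · simp only [ballGlue, hxρ, if_false]
        exact hWU x hx) x₀ (subset_closure hx₀)
    simp only [ballGlue, dist_self, hρ, if_true] at h1
    have h2 := (le_max_right _ _).trans h1
    simp only [hq, hs', quadraticAt_self] at h2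
    linarith
  · intro x hx
    refine le_of_forall_pos_le_add fun ε hε => ?_
    obtain ⟨w, hw, hws, hwx⟩ := hlow x hx ε hε
    have := hWmax w (hw.lowerSemicontinuous.lowerSemicontinuousOn _) (hmax w hws) x
      (frontier_subset_closure hx)
    linarith

end Perron

/-! ### Boundary barriers and conclusion -/

section Barriers

variable {n : ℕ}

local notation "𝔼" => EuclideanSpace ℝ (Fin n)

/-- At each boundary point the whole domain satisfies the curvature bound, for a smaller constant
depending on the point. -/
theorem IsUniformlyConvexDomain.exists_forall_mem_closure {Ω : Set 𝔼}
    (hΩ : IsUniformlyConvexDomain Ω) (hb : Bornology.IsBounded Ω) {x₀ : 𝔼}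
    (hx₀ : x₀ ∈ frontier Ω) :
    ∃ κ : ℝ, 0 < κ ∧ ∃ ν : 𝔼, ∀ x ∈ closure Ω, κ / 2 * ‖x - x₀‖ ^ 2 ≤ ⟪ν, x - x₀⟫ := by
  obtain ⟨κ, hκ, hcurv⟩ := hΩ.curvature
  obtain ⟨ν, -, hν⟩ := hcurv x₀ hx₀
  rw [eventually_nhdsWithin_iff] at hν
  obtain ⟨r, hr, hball⟩ := Metric.eventually_nhds_iff_ball.1 hν
  obtain ⟨R, hR, hRΩ⟩ := hb.exists_pos_norm_le
  set D := R + ‖x₀‖ + r with hD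
  have hD0 : 0 < D := by positivity
  -- Shrinking Ω towards x₀ by t brings it into the ball where the curvature bound holds; rescaling
  -- turns κ into tκ. The summand r in D ensures t < 1.
  set t := r / (2 * D) with ht
  have ht0 : 0 < t := by positivity
  have htD : t * D = r / 2 := by rw [ht]; field_simp
  have ht1 : t < 1 := by
    rw [ht, div_lt_one (by positivity)]
    linarith [norm_nonneg x₀]
  refine ⟨t * κ, by positivity, ν, fun x hx => ?_⟩
  have hcl : IsClosed {x : 𝔼 | t * κ / 2 * ‖x - x₀‖ ^ 2 ≤ ⟪ν, x - x₀⟫} :=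
    isClosed_le (by fun_prop) (by fun_prop)
  refine closure_minimal (fun x hx => ?_) hcl hx
  have hmem : x₀ + t • (x - x₀) ∈ Ω := by
    have h1 : openSegment ℝ x₀ x ⊆ interior Ω :=
      hΩ.convex.openSegment_closure_interior_subset_interior (frontier_subset_closure hx₀)
        (by rwa [hΩ.isOpen.interior_eq])
    rw [hΩ.isOpen.interior_eq] at h1
    apply h1
    rw [openSegment_eq_image']
    exact ⟨t, ⟨ht0, ht1⟩, rfl⟩
  have hnorm : ‖t • (x - x₀)‖ < r := by
    rw [norm_smul, Real.norm_of_nonneg ht0.le]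
    calc t * ‖x - x₀‖ ≤ t * D := by
          gcongr
          linarith [norm_sub_le x x₀, hRΩ x hx]
      _ < r := by linarith
  have h2 := hball (x₀ + t • (x - x₀)) (by
    rwa [Metric.mem_ball, dist_eq_norm, add_sub_cancel_left]) hmem
  rw [add_sub_cancel_left, norm_smul, Real.norm_of_nonneg ht0.le, real_inner_smul_left,
    real_inner_comm] at h2
  have h3 : t * (t * κ / 2 * ‖x - x₀‖ ^ 2) ≤ t * ⟪ν, x - x₀⟫ := by linarith
  exact le_of_mul_le_mul_left h3 ht0

/-- The opening of the quadratic barriers at a boundary point. -/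
theorem exists_barrier_opening {Ω : Set 𝔼} (hb : Bornology.IsBounded Ω) {φ : 𝔼 → ℝ}
    (hφ : ContinuousOn φ (frontier Ω)) {ψ : ℝ}
    (hψ : ψ ∈ Ioo (-(n * (Real.pi / 2))) (n * (Real.pi / 2))) {x₀ : 𝔼} (hx₀ : x₀ ∈ frontier Ω)
    {ε : ℝ} (hε : 0 < ε) :
    ∃ c : ℝ, 0 < c ∧ (∀ x ∈ frontier Ω, |φ x - φ x₀| ≤ ε + c / 2 * ‖x - x₀‖ ^ 2) ∧
      |ψ| ≤ n * Real.arctan c := by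
  have hK : IsCompact (frontier Ω) :=
    hb.isCompact_closure.of_isClosed_subset isClosed_frontier frontier_subset_closure
  obtain ⟨m, hm⟩ := hK.exists_bound_of_continuousOn hφ
  have hm' : ∀ x ∈ frontier Ω, |φ x| ≤ m := hm
  have hm0 : 0 ≤ m := (abs_nonneg _).trans (hm' x₀ hx₀)
  obtain ⟨r, hr, hrφ⟩ := Metric.continuousWithinAt_iff.1 (hφ x₀ hx₀) ε hε
  have hlim : Filter.Tendsto (fun c => n * Real.arctan c) Filter.atTop (𝓝 (n * (Real.pi / 2))) :=
    (Real.tendsto_arctan_atTop.mono_right nhdsWithin_le_nhds).const_mul _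
  have hψ' : |ψ| < n * (Real.pi / 2) := abs_lt.2 ⟨hψ.1, hψ.2⟩
  -- Within distance r the oscillation of φ is below ε; beyond it the oscillation, at most 2m, is
  -- below c r²/2.
  obtain ⟨c, hc1, hc2⟩ := ((hlim.eventually (lt_mem_nhds hψ')).and
    (Filter.eventually_ge_atTop (1 + 4 * m / r ^ 2))).exists
  have hc0 : 0 < c := by
    have : 0 ≤ 4 * m / r ^ 2 := by positivity
    linarith
  refine ⟨c, hc0, fun x hx => ?_, hc1.le⟩
  rcases lt_or_ge (dist x x₀) r with h | h
  · have h1 := (hrφ hx h).le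
    rw [Real.dist_eq] at h1
    have : 0 ≤ c / 2 * ‖x - x₀‖ ^ 2 := by positivity
    linarith
  · rw [dist_eq_norm] at h
    have h1 := abs_sub (φ x) (φ x₀)
    have h2 : 4 * m / r ^ 2 * r ^ 2 ≤ c * ‖x - x₀‖ ^ 2 := by
      have : 4 * m / r ^ 2 ≤ c := by linarith
      gcongr
    rw [div_mul_cancel₀ _ (by positivity)] at h2
    linarith [hm' x hx, hm' x₀ hx₀]

theorem operatorPhase_smul_id_euclidean (c : ℝ) :
    operatorPhase (c • ContinuousLinearMap.id ℝ 𝔼) = n * Real.arctan c := by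
  rw [operatorPhase_smul_id, finrank_euclideanSpace, Fintype.card_fin]

/-- Take φ(x₀) - ε - (2c/κ)⟪ν, x - x₀⟫ + c/2 |x - x₀|². On ∂Ω the linear term is at most -c|x -
x₀|², so it overcomes the convex term and leaves -c/2 |x - x₀|², while the Hessian cI has phase at
least ψ. The upper barrier is the mirror image. -/
theorem IsUniformlyConvexDomain.exists_lower_barrier {Ω : Set 𝔼} (hΩ : IsUniformlyConvexDomain Ω)
    (hb : Bornology.IsBounded Ω) {φ : 𝔼 → ℝ} (hφ : ContinuousOn φ (frontier Ω)) {ψ : ℝ}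
    (hψ : ψ ∈ Ioo (-(n * (Real.pi / 2))) (n * (Real.pi / 2))) {x₀ : 𝔼} (hx₀ : x₀ ∈ frontier Ω)
    {ε : ℝ} (hε : 0 < ε) :
    ∃ w : 𝔼 → ℝ, Continuous w ∧ IsPerronCompetitor Ω ψ φ w ∧ φ x₀ - ε ≤ w x₀ := by
  obtain ⟨κ, hκ, ν, hν⟩ := hΩ.exists_forall_mem_closure hb hx₀
  obtain ⟨c, hc, hcφ, hcψ⟩ := exists_barrier_opening hb hφ hψ hx₀ hε
  have hw := continuous_quadraticAt x₀ (φ x₀ - ε) ((-(2 * c / κ)) • ν)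
    (c • ContinuousLinearMap.id ℝ 𝔼)
  refine ⟨_, hw, ⟨hw.upperSemicontinuous.upperSemicontinuousOn _,
    isJetSubsolution_quadraticAt Ω _ _ _ (isSymmetric_smul_id c) ?_, fun x hx => ?_⟩,
    (quadraticAt_self _ _ _ _).ge⟩
  · rw [operatorPhase_smul_id_euclidean]
    exact (le_abs_self ψ).trans hcψ
  · have h1 := hν x (frontier_subset_closure hx)
    have h2 := (abs_le.1 (hcφ x hx)).1
    have h3 : 2 * c / κ * (κ / 2 * ‖x - x₀‖ ^ 2) ≤ 2 * c / κ * ⟪ν, x - x₀⟫ := by gcongr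
    have h4 : 2 * c / κ * (κ / 2 * ‖x - x₀‖ ^ 2) = c * ‖x - x₀‖ ^ 2 := by field_simp
    simp only [quadraticAt, real_inner_smul_left, _root_.smul_apply, ContinuousLinearMap.id_apply,
      real_inner_self_eq_norm_sq]
    linarith

theorem IsUniformlyConvexDomain.exists_upper_barrier {Ω : Set 𝔼} (hΩ : IsUniformlyConvexDomain Ω)
    (hb : Bornology.IsBounded Ω) {φ : 𝔼 → ℝ} (hφ : ContinuousOn φ (frontier Ω)) {ψ : ℝ}
    (hψ : ψ ∈ Ioo (-(n * (Real.pi / 2))) (n * (Real.pi / 2))) {x₀ : 𝔼} (hx₀ : x₀ ∈ frontier Ω)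
    {ε : ℝ} (hε : 0 < ε) :
    ∃ W : 𝔼 → ℝ, Continuous W ∧ IsJetSupersolution Ω ψ W ∧ (∀ x ∈ frontier Ω, φ x ≤ W x) ∧
      W x₀ ≤ φ x₀ + ε := by
  obtain ⟨κ, hκ, ν, hν⟩ := hΩ.exists_forall_mem_closure hb hx₀
  obtain ⟨c, hc, hcφ, hcψ⟩ := exists_barrier_opening hb hφ hψ hx₀ hε
  refine ⟨_, continuous_quadraticAt x₀ (φ x₀ + ε) ((2 * c / κ) • ν)
    ((-c) • ContinuousLinearMap.id ℝ 𝔼),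
    isJetSupersolution_quadraticAt Ω _ _ _ (isSymmetric_smul_id (-c)) ?_, fun x hx => ?_,
    (quadraticAt_self _ _ _ _).le⟩
  · rw [operatorPhase_smul_id_euclidean, Real.arctan_neg]
    linarith [neg_abs_le ψ]
  · have h1 := hν x (frontier_subset_closure hx)
    have h2 := (abs_le.1 (hcφ x hx)).2
    have h3 : 2 * c / κ * (κ / 2 * ‖x - x₀‖ ^ 2) ≤ 2 * c / κ * ⟪ν, x - x₀⟫ := by gcongr
    have h4 : 2 * c / κ * (κ / 2 * ‖x - x₀‖ ^ 2) = c * ‖x - x₀‖ ^ 2 := by field_simp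
    simp only [quadraticAt, real_inner_smul_left, _root_.smul_apply, ContinuousLinearMap.id_apply,
      real_inner_self_eq_norm_sq]
    linarith

theorem IsDirichletSolution.le [NeZero n] {Ω : Set 𝔼} (hΩ : IsOpen Ω)
    (hb : Bornology.IsBounded Ω) {ψ : ℝ} {φ u v : 𝔼 → ℝ} (hu : IsDirichletSolution Ω ψ φ u)
    (hv : IsDirichletSolution Ω ψ φ v) : ∀ x ∈ closure Ω, u x ≤ v x :=
  ((isViscositySubsolution_iff hΩ).1 hu.subsolution).2.le_of_le_frontier hΩ hb
    hu.continuousOn.upperSemicontinuousOn hv.continuousOn.lowerSemicontinuousOn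
    ((isViscositySupersolution_iff hΩ).1 hv.supersolution).2
    fun x hx => (hu.boundary x hx).trans_le (hv.boundary x hx).ge

/-- Comparison between the greatest competitor and its lower hull gives the inequality opposite to
the trivial one, hence continuity up to the boundary. -/
theorem IsUniformlyConvexDomain.exists_isDirichletSolution [NeZero n] {Ω : Set 𝔼}
    (hΩ : IsUniformlyConvexDomain Ω) (hb : Bornology.IsBounded Ω) {φ : 𝔼 → ℝ}
    (hφ : ContinuousOn φ (frontier Ω)) {ψ : ℝ}
    (hψ : ψ ∈ Ioo (-(n * (Real.pi / 2))) (n * (Real.pi / 2))) :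
    ∃ u, IsDirichletSolution Ω ψ φ u := by
  have hne : (frontier Ω).Nonempty := by
    rw [nonempty_frontier_iff]
    refine ⟨hΩ.nonempty, fun huniv => ?_⟩
    rw [huniv] at hb
    exact NormedSpace.unbounded_univ ℝ 𝔼 hb
  obtain ⟨x₀, hx₀⟩ := hne
  obtain ⟨w₀, hw₀c, hw₀, -⟩ := hΩ.exists_lower_barrier hb hφ hψ hx₀ one_pos
  obtain ⟨W₀, hW₀c, hW₀s, hW₀b, -⟩ := hΩ.exists_upper_barrier hb hφ hψ hx₀ one_pos
  obtain ⟨u, hu, hmax⟩ := exists_greatest_isPerronCompetitor hΩ.isOpen hb hw₀ hW₀c hW₀s hW₀b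
    fun x hx ε hε => hΩ.exists_upper_barrier hb hφ hψ hx hε
  obtain ⟨v, hv, hvs, hvu, hvb⟩ := exists_isJetSupersolution_le hΩ.isOpen hu hmax hw₀c hw₀
    fun x hx ε hε => hΩ.exists_lower_barrier hb hφ hψ hx hε
  have huv := hu.sub.le_of_le_frontier hΩ.isOpen hb hu.usc hv hvs
    fun x hx => (hu.boundary x hx).trans (hvb x hx)
  have heq : EqOn u v (closure Ω) := fun x hx => le_antisymm (huv x hx) (hvu x hx)
  have hlsc : LowerSemicontinuousOn u (closure Ω) := fun x hx c hc => by
    have hc' : c < v x := heq hx ▸ hc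
    filter_upwards [hv x hx c hc', self_mem_nhdsWithin] with y hy hyK
    exact (heq hyK).symm ▸ hy
  refine ⟨u, continuousOn_iff_lower_upperSemicontinuousOn.2 ⟨hlsc, hu.usc⟩,
    (isViscositySubsolution_iff hΩ.isOpen).2 ⟨hu.usc.mono subset_closure, hu.sub⟩,
    (isViscositySupersolution_iff hΩ.isOpen).2 ⟨hlsc.mono subset_closure, ?_⟩, fun x hx => ?_⟩
  · intro x hx b T hT hj
    refine hvs x hx b T hT (hj.congr ?_)
    filter_upwards [hΩ.isOpen.mem_nhds hx] with y hy
    rw [heq (subset_closure hy)]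
  · exact le_antisymm (hu.boundary x hx)
      ((hvb x hx).trans (hvu x (frontier_subset_closure hx)))

end Barriers

end

theorem theorem1p2 {n : ℕ} (Ω : Set (EuclideanSpace ℝ (Fin n)))
    (hΩ : IsUniformlyConvexDomain Ω) (hΩb : Bornology.IsBounded Ω)
    (φ : EuclideanSpace ℝ (Fin n) → ℝ) (hφ : ContinuousOn φ (frontier Ω))
    (ψ : ℝ) (hψ : ψ ∈ Set.Ioo (-(n * (Real.pi / 2))) (n * (Real.pi / 2))) :
    ∃ u : EuclideanSpace ℝ (Fin n) → ℝ, IsDirichletSolution Ω ψ φ u ∧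
      ∀ v : EuclideanSpace ℝ (Fin n) → ℝ, IsDirichletSolution Ω ψ φ v →
        Set.EqOn v u (closure Ω) := by
  -- For n = 0 the interval for ψ is empty; strict monotonicity of the phase needs n > 0.
  have hn : NeZero n := ⟨by
    rintro rfl
    have := hψ.1.trans hψ.2
    simp at this⟩
  obtain ⟨u, hu⟩ := hΩ.exists_isDirichletSolution hΩb hφ hψ
  exact ⟨u, hu, fun v hv x hx =>
    le_antisymm (hv.le hΩ.isOpen hΩb hu x hx) (hu.le hΩ.isOpen hΩb hv x hx)⟩
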